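/- Let $S$ be a Polish space with a fixed metric inducing its topology (completeness of the metric and local compactness of $S$ are not assumed). Let $\mathcal S$ be its Borel $\sigma$-field, $\mathcal S_b\subset\mathcal S$ the ring of bounded Borel sets, and $\mathbf M(S)$ the set of measures $\mu$ on $(S,\mathcal S)$ with $\mu(B)<\infty$ for all $B\in\mathcal S_b$, with the $\sigma$-field generated by the maps $\mu\mapsto\mu(B)$, $B\in\mathcal S$, and the partial order $\mu\le\nu$ iff $\mu(B)\le\nu(B)$ for all $B\in\mathcal S_b$. A random measure $M$ on $S$ is a measurable map from a probability space into $\mathbf M(S)$. For $A\in\mathcal S$, a function on $\mathbf M(S)$ is called measurable with respect to $A$ if it is measurable for the $\sigma$-field generated by the maps $\mu\mapsto\mu(B)$, $B\in\mathcal S$, $B\subseteq A$. The random measure $M$ is NA if $\mathbb E[f(M)g(M)]\le\mathbb E[f(M)]\,\mathbb E[g(M)]$ for all bounded non-decreasing $f,g\colon\mathbf M(S)\to\mathbb R$ that are measurable with respect to $A$ and $B$, respectively, for some disjoint $A,B\in\mathcal S$. It is PA if $\mathbb E[f(M)g(M)]\ge\mathbb E[f(M)]\,\mathbb E[g(M)]$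 for all bounded measurable non-decreasing $f,g\colon\mathbf M(S)\to\mathbb R$. A real random vector $X=(X_1,\dots,X_n)$ is NA if $\mathbb E[f(X_J)g(X_{J^c})]\le\mathbb E[f(X_J)]\,\mathbb E[g(X_{J^c})]$ for all $J\subseteq\{1,\dots,n\}$ and all bounded measurable coordinatewise non-decreasing $f\colon\mathbb R^J\to\mathbb R$, $g\colon\mathbb R^{J^c}\to\mathbb R$, where $X_J=(X_i)_{i\in J}$. It is PA if $\mathbb E[f(X_J)g(X_J)]\ge\mathbb E[f(X_J)]\,\mathbb E[g(X_J)]$ for all $J\subseteq\{1,\dots,n\}$ and all bounded measurable coordinatewise non-decreasing $f,g\colon\mathbb R^J\to\mathbb R$. Let $\mathcal I\subset\mathcal S_b$ be a countable semi-ring that generates $\mathcal S$ and is topological and dissecting, that is, every open subset of $S$ is a countable union of sets in $\mathcal I$, and every bounded subset of $S$ is covered by finitely many sets in $\mathcal I$. **Theorem.** Let $M$ be a random measure on $S$. Then $M$ is NA if and only if $(M(B_1),\dots,M(B_n))$ is NA for all $n\ge1$ and all pairwise disjoint $B_1,\dots,B_n\in\mathcal I$. Likewise, $M$ is PA if and only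 if $(M(B_1),\dots,M(B_n))$ is PA for all $n\ge1$ and all pairwise disjoint $B_1,\dots,B_n\in\mathcal I$. -/

import Mathlib

open MeasureTheory

/-- A family `X = (X i)` of random elements of a partially ordered space `E` is negatively
associated (NA) under `P`: for every subset `J` of the index set, bounded measurable
coordinatewise non-decreasing functions of `(X i)_{i ∈ J}` and of `(X i)_{i ∉ J}` are
non-positively correlated. -/
def IsNegAssociated {Ω ι E : Type*} [MeasurableSpace Ω] [Preorder E] [MeasurableSpace E]
    (P : Measure Ω) (X : ι → Ω → E) : Prop :=
  ∀ (J : Set ι) (f : (J → E) → ℝ) (g : ((Jᶜ : Set ι) → E) → ℝ),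
    Measurable f → Measurable g → Monotone f → Monotone g →
    (∃ C, ∀ x, |f x| ≤ C) → (∃ C, ∀ x, |g x| ≤ C) →
    ∫ ω, f (fun i => X i ω) * g (fun i => X i ω) ∂P ≤
      (∫ ω, f (fun i => X i ω) ∂P) * ∫ ω, g (fun i => X i ω) ∂P

/-- A family `X = (X i)` of random elements of a partially ordered space `E` is positively
associated (PA) under `P`: for every subset `J` of the index set, any two bounded measurable
coordinatewise non-decreasing functions of `(X i)_{i ∈ J}` are non-negatively correlated. -/
def IsPosAssociated {Ω ι E : Type*} [MeasurableSpace Ω] [Preorder E] [MeasurableSpace E]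
    (P : Measure Ω) (X : ι → Ω → E) : Prop :=
  ∀ (J : Set ι) (f g : (J → E) → ℝ),
    Measurable f → Measurable g → Monotone f → Monotone g →
    (∃ C, ∀ x, |f x| ≤ C) → (∃ C, ∀ x, |g x| ≤ C) →
    (∫ ω, f (fun i => X i ω) ∂P) * ∫ ω, g (fun i => X i ω) ∂P ≤
      ∫ ω, f (fun i => X i ω) * g (fun i => X i ω) ∂P

/-- The space `𝐌(S)` of Borel measures on `S` that are finite on bounded Borel sets.
As a subtype of `Measure S` it carries the smallest `σ`-field making all evaluations
`μ ↦ μ B`, `B` Borel, measurable, and the setwise partial order of measures. -/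
abbrev LocFinMeasure (S : Type*) [MetricSpace S] [MeasurableSpace S] : Type _ :=
  {μ : Measure S // ∀ B : Set S, MeasurableSet B → Bornology.IsBounded B → μ B < ⊤}

/-- The `σ`-field `𝓕(A)` on `𝐌(S)` generated by the evaluations `μ ↦ μ B` for Borel `B ⊆ A`. -/
abbrev evalSigma {S : Type*} [MetricSpace S] [MeasurableSpace S] (A : Set S) :
    MeasurableSpace (LocFinMeasure S) :=
  ⨆ (B : Set S) (_ : MeasurableSet B) (_ : B ⊆ A),
    MeasurableSpace.comap (fun μ : LocFinMeasure S => (μ : Measure S) B) ENNReal.measurableSpace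

/-- The random measure `M` is negatively associated: bounded non-decreasing functions on `𝐌(S)`
that are measurable with respect to disjoint Borel sets are non-positively correlated
when evaluated at `M`. -/
def IsNegAssociatedRM {Ω S : Type*} [MeasurableSpace Ω] [MetricSpace S] [MeasurableSpace S]
    (P : Measure Ω) (M : Ω → LocFinMeasure S) : Prop :=
  ∀ (A B : Set S), MeasurableSet A → MeasurableSet B → Disjoint A B →
    ∀ f g : LocFinMeasure S → ℝ,
      Measurable[evalSigma A] f → Measurable[evalSigma B] g → Monotone f → Monotone g →
      (∃ C, ∀ μ, |f μ| ≤ C) → (∃ C, ∀ μ, |g μ| ≤ C) →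
      ∫ ω, f (M ω) * g (M ω) ∂P ≤ (∫ ω, f (M ω) ∂P) * ∫ ω, g (M ω) ∂P

/-- The random measure `M` is positively associated: any two bounded measurable non-decreasing
functions on `𝐌(S)` are non-negatively correlated when evaluated at `M`. -/
def IsPosAssociatedRM {Ω S : Type*} [MeasurableSpace Ω] [MetricSpace S] [MeasurableSpace S]
    (P : Measure Ω) (M : Ω → LocFinMeasure S) : Prop :=
  ∀ f g : LocFinMeasure S → ℝ,
    Measurable f → Measurable g → Monotone f → Monotone g →
    (∃ C, ∀ μ, |f μ| ≤ C) → (∃ C, ∀ μ, |g μ| ≤ C) →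
    (∫ ω, f (M ω) ∂P) * ∫ ω, g (M ω) ∂P ≤ ∫ ω, f (M ω) * g (M ω) ∂P

/-- `I` is a countable, topological, dissecting semi-ring of bounded Borel sets that generates
the Borel `σ`-field. -/
structure IsCountableDissectingSemiring {S : Type*} [MetricSpace S] [MeasurableSpace S]
    (I : Set (Set S)) : Prop where
  countable : I.Countable
  isSetSemiring : IsSetSemiring I
  measurableSet : ∀ B ∈ I, MeasurableSet B
  isBounded : ∀ B ∈ I, Bornology.IsBounded B
  /-- Every open set is a countable union of sets in `I`. -/
  topological : ∀ G : Set S, IsOpen G → ∃ C ⊆ I, C.Countable ∧ G = ⋃₀ C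
  /-- Every bounded set is covered by finitely many sets in `I`. -/
  dissecting : ∀ B : Set S, Bornology.IsBounded B → ∃ C ⊆ I, C.Finite ∧ B ⊆ ⋃₀ C
  generates : MeasurableSpace.generateFrom I = ‹MeasurableSpace S›

/-! The evaluations at members of `I` embed the locally finite measures into the Polish space `I →
ℝ`. The embedding preserves and reflects the order, and it generates the σ-field. Finite-dimensional
association yields the correlation inequality for continuous non-decreasing functions of finitely
many coordinates: finitely many members of `I` are refined into disjoint ones, and the mass of each
is a sum, hence a non-decreasing function, of the masses of the pieces. It remains to approximate
bounded non-decreasing functionals in mean by such cylinder functions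
(`exists_isMonotoneCylinder_approx`). Averaging superlevel sets reduces this to an upper set `U`.

Let `U` be the preimage of a Borel set `V`, and let `L` be a compact subset of `V` carrying most of
the law. The indicator of the upper closure of `L` is a limit of monotone cylinder functions.
However, `V` need not be an upper set, and a point of `L` that is no measure says nothing about the
measures above it. Hence `L` must consist of evaluations of measures, and compact sets of this kind
must carry almost all of the law (`exists_isCompact_subset_range_evalOn`). Without local compactness
this comes from tightness. Membership in the sets of `I` maps `S` injectively into the Cantor-like
space `I → Bool`, where members of `I` become traces of clopen sets. Compact sets there give sets on
which countable covers reduce to finite ones, so limits of uniformly tight measures stay σ-additive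
(`closure_image_evalOn_subset_range`).

For negative association, `f` and `g` see only the restrictions of `M` to `A` and to its complement,
and are approximated along these restrictions. The set `A` is then replaced by ring sets, for which
the pieces of a refinement split into those inside and those not inside; continuity of the cylinder
functions gives the limit (`integral_mul_le_of_restrict`). -/

open Set Filter Topology
open scoped ENNReal symmDiff

/-! ### Refinements and countable partitions -/

/-- Finitely many members of the ring generated by a semiring have a common refinement by
finitely many pairwise disjoint members of the semiring. -/
theorem MeasureTheory.IsSetSemiring.exists_disjoint_refinement {α : Type*} {C : Set (Set α)}
    (hC : IsSetSemiring C) (F : Finset (Set α)) (hF : ↑F ⊆ supClosure C) :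
    ∃ G : Finset (Set α), ↑G ⊆ C ∧ (G : Set (Set α)).PairwiseDisjoint id ∧
      ∀ E ∈ F, E = ⋃₀ {D | D ∈ G ∧ D ⊆ E} := by
  classical
  have hR := hC.isSetRing_supClosure
  -- The atoms of `F`: points lying in exactly those members of `F` that belong to `T`.
  let cell : Finset (Set α) → Set α := fun T => {x | ∀ B ∈ F, x ∈ B ↔ B ∈ T}
  have hcell : ∀ T, T ⊆ F → T.Nonempty → cell T ∈ supClosure C := by
    rintro T hT ⟨B₀, hB₀⟩
    -- A ring need not contain the whole space, so complements are taken relative to one member `B₀`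
    -- of `T`; this is why `T` must be nonempty.
    have : cell T = B₀ \ ⋃ B ∈ F, (if B ∈ T then B₀ \ B else B) := by
      ext x
      simp only [cell, mem_ofPred_eq, Set.mem_sdiff, mem_iUnion, not_exists]
      constructor
      · intro h
        refine ⟨(h B₀ (hT hB₀)).2 hB₀, fun B hB => ?_⟩
        have := h B hB
        split_ifs with hBT <;> simp_all
      · rintro ⟨h0, h⟩ B hB
        have := h B hB
        split_ifs at this with hBT <;> simp_all
    rw [this]
    refine hR.sdiff_mem (hF (hT hB₀)) (hR.biUnion_mem _ fun B hB => ?_)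
    split_ifs
    · exact hR.sdiff_mem (hF (hT hB₀)) (hF hB)
    · exact hF hB
  choose! P hP using fun T (hT : T ⊆ F) (hn : T.Nonempty) =>
    show ∃ P : Finset (Set α), ↑P ⊆ C ∧ (P : Set (Set α)).PairwiseDisjoint id ∧ ⋃₀ ↑P = cell T by
      obtain ⟨P, hP⟩ := hC.mem_supClosure_iff.1 (hcell T hT hn)
      exact ⟨P.parts, hP, P.disjoint,
        (Finset.sup_id_set_eq_sUnion _).symm.trans P.sup_parts⟩
  refine ⟨(F.powerset.filter Finset.Nonempty).biUnion P, ?_, ?_, ?_⟩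
  · intro D hD
    simp only [Finset.coe_biUnion, mem_iUnion, Finset.mem_coe, Finset.mem_filter,
      Finset.mem_powerset] at hD
    obtain ⟨T, ⟨hT, hn⟩, hD⟩ := hD
    exact (hP T hT hn).1 hD
  · intro D hD D' hD' hne
    simp only [Finset.coe_biUnion, mem_iUnion, Finset.mem_coe, Finset.mem_filter,
      Finset.mem_powerset] at hD hD'
    obtain ⟨T, ⟨hT, hn⟩, hD⟩ := hD
    obtain ⟨T', ⟨hT', hn'⟩, hD'⟩ := hD'
    by_cases h : T = T'
    · subst h
      exact (hP T hT hn).2.1 hD hD' hne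
    · have h1 : D ⊆ cell T := (hP T hT hn).2.2 ▸ subset_sUnion_of_mem hD
      have h2 : D' ⊆ cell T' := (hP T' hT' hn').2.2 ▸ subset_sUnion_of_mem hD'
      refine disjoint_left.2 fun x hx hx' => h ?_
      ext B
      constructor
      · intro hB
        exact ((h2 hx') B (hT hB)).1 (((h1 hx) B (hT hB)).2 hB)
      · intro hB
        exact ((h1 hx) B (hT' hB)).1 (((h2 hx') B (hT' hB)).2 hB)
  · intro E hE
    refine subset_antisymm (fun x hx => ?_) (sUnion_subset fun D hD => hD.2)
    let T := F.filter (x ∈ ·)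
    have hT : T ⊆ F := Finset.filter_subset _ _
    have hET : E ∈ T := by simp [T, hE, hx]
    have hn : T.Nonempty := ⟨E, hET⟩
    have hxT : x ∈ cell T := by
      intro B hB
      simp [T, hB]
    rw [← (hP T hT hn).2.2] at hxT
    obtain ⟨D, hD, hxD⟩ := hxT
    refine ⟨D, ⟨?_, fun y hy => ?_⟩, hxD⟩
    · simp only [Finset.mem_biUnion, Finset.mem_filter, Finset.mem_powerset]
      exact ⟨T, ⟨hT, hn⟩, hD⟩
    · have : y ∈ cell T := (hP T hT hn).2.2 ▸ mem_sUnion_of_mem hy hD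
      exact (this E hE).2 hET

/-- The measure of a set is the sum of the measures of its traces on a partition subordinate
to a countable cover. -/
theorem MeasureTheory.measure_eq_tsum_inter_disjointed {α : Type*} [MeasurableSpace α]
    (μ : Measure α) {W : ℕ → Set α}
    (hWm : ∀ n, MeasurableSet (W n)) (hU : ⋃ n, W n = univ) {E : Set α}
    (hE : MeasurableSet E) :
    μ E = ∑' n, μ (E ∩ disjointed W n) := by
  rw [← measure_iUnion, ← inter_iUnion, iUnion_disjointed, hU, inter_univ]
  · exact fun i j hij => (disjoint_disjointed W hij).mono inter_subset_right inter_subset_right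
  · exact fun n => hE.inter (MeasurableSet.disjointed hWm n)

/-! ### Approximation by ring sets and the order of measures -/

namespace IsCountableDissectingSemiring

variable {S : Type*} [MetricSpace S] [MeasurableSpace S] {I : Set (Set S)}

theorem exists_seq_cover (hI : IsCountableDissectingSemiring I) :
    ∃ W : ℕ → Set S, (∀ n, W n ∈ I) ∧ ⋃ n, W n = univ := by
  obtain ⟨C, hCI, hC, hU⟩ := hI.topological univ isOpen_univ
  obtain ⟨W, hW⟩ := (hC.insert ∅).exists_eq_range (insert_nonempty _ _)
  refine ⟨W, fun n => ?_, ?_⟩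
  · have : W n ∈ insert ∅ C := hW ▸ mem_range_self n
    rcases this with h | h
    · exact h ▸ hI.isSetSemiring.empty_mem
    · exact hCI h
  · rw [← sUnion_range, ← hW, sUnion_insert, empty_union, ← hU]

theorem measurableSet_supClosure (hI : IsCountableDissectingSemiring I) {R : Set S}
    (hR : R ∈ supClosure I) : MeasurableSet R := by
  obtain ⟨P, hP⟩ := hI.isSetSemiring.mem_supClosure_iff.1 hR
  rw [← P.sup_parts, Finset.sup_id_set_eq_sUnion]
  exact MeasurableSet.sUnion P.parts.countable_toSet fun B hB => hI.measurableSet B (hP hB)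

/-- Approximation of a Borel set by finite unions of members of the semiring. -/
theorem exists_supClosure_symmDiff_lt (hI : IsCountableDissectingSemiring I) (μ : Measure S)
    [IsFiniteMeasure μ] {E : Set S} (hE : MeasurableSet E) {ε : ℝ≥0∞} (hε : 0 < ε) :
    ∃ R ∈ supClosure I, μ (R ∆ E) < ε := by
  obtain ⟨W, hW, hU⟩ := hI.exists_seq_cover
  refine exists_measure_symmDiff_lt_of_generateFrom_isSetSemiring hI.isSetSemiring
    ⟨range W, countable_range W, range_subset_iff.2 hW, ?_⟩ hI.generates.symm hE hε
  simp [hU]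

theorem measure_lt_top (hI : IsCountableDissectingSemiring I) (μ : LocFinMeasure S) {B : Set S}
    (hB : B ∈ I) : (μ : Measure S) B < ∞ :=
  μ.2 B (hI.measurableSet B hB) (hI.isBounded B hB)

/-- The order on locally finite measures is determined by the values on the semiring. -/
theorem le_of_forall_le (hI : IsCountableDissectingSemiring I) {μ ν : LocFinMeasure S}
    (h : ∀ B ∈ I, (μ : Measure S) B ≤ (ν : Measure S) B) : μ ≤ ν := by
  have hR : ∀ R ∈ supClosure I, (μ : Measure S) R ≤ (ν : Measure S) R := by
    intro R hR
    obtain ⟨P, hP⟩ := hI.isSetSemiring.mem_supClosure_iff.1 hR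
    have key : ∀ ρ : Measure S, ρ R = ∑ B ∈ P.parts, ρ B := by
      intro ρ
      conv_lhs => rw [← P.sup_parts, Finset.sup_id_set_eq_sUnion, sUnion_eq_biUnion]
      exact measure_biUnion_finset P.disjoint fun B hB => hI.measurableSet B (hP hB)
    rw [key, key]
    exact Finset.sum_le_sum fun B hB => h B (hP hB)
  have hring := hI.isSetSemiring.isSetRing_supClosure
  have hloc : ∀ W ∈ I, ∀ E, MeasurableSet E → E ⊆ W →
      (μ : Measure S) E ≤ (ν : Measure S) E := by
    intro W hW E hE hEW
    have hWm := hI.measurableSet W hW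
    -- Approximating for the sum gives one ring set `R` that is close to `E` for both measures at
    -- once.
    let ρ : Measure S := ((μ : Measure S) + (ν : Measure S)).restrict W
    have : IsFiniteMeasure ρ := ⟨by
      simp [ρ, hI.measure_lt_top μ hW, hI.measure_lt_top ν hW]⟩
    refine ENNReal.le_of_forall_pos_le_add fun ε hε _ => ?_
    have hε2 : (0 : ℝ≥0∞) < ε / 2 := ENNReal.half_pos (by exact_mod_cast hε.ne')
    obtain ⟨R, hRI, hRE⟩ := hI.exists_supClosure_symmDiff_lt ρ hE hε2
    have hRm := hI.measurableSet_supClosure hRI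
    have hρ : ρ (R ∆ E) = (μ : Measure S) (R ∆ E ∩ W) + (ν : Measure S) (R ∆ E ∩ W) := by
      simp [ρ, Measure.restrict_apply (hRm.symmDiff hE)]
    have h1 : (μ : Measure S) (R ∆ E ∩ W) ≤ ε / 2 := by
      refine le_trans ?_ hRE.le
      rw [hρ]; exact le_self_add
    have h2 : (ν : Measure S) (R ∆ E ∩ W) ≤ ε / 2 := by
      refine le_trans ?_ hRE.le
      rw [hρ]; exact le_add_self
    calc (μ : Measure S) E ≤ (μ : Measure S) ((R ∩ W) ∪ (R ∆ E ∩ W)) := by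
          refine measure_mono fun x hx => ?_
          have := hEW hx
          by_cases hxR : x ∈ R
          · exact Or.inl ⟨hxR, this⟩
          · exact Or.inr ⟨Or.inr ⟨hx, hxR⟩, this⟩
      _ ≤ (μ : Measure S) (R ∩ W) + ε / 2 := (measure_union_le _ _).trans (by gcongr)
      _ ≤ (ν : Measure S) (R ∩ W) + ε / 2 := by
          refine add_le_add_left ?_ _
          exact hR _ (hring.inter_mem hRI (subset_supClosure hW))
      _ ≤ (ν : Measure S) (E ∪ (R ∆ E ∩ W)) + ε / 2 := by
          gcongr
          rintro x ⟨hxR, hxW⟩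
          by_cases hxE : x ∈ E
          · exact Or.inl hxE
          · exact Or.inr ⟨Or.inl ⟨hxR, hxE⟩, hxW⟩
      _ ≤ (ν : Measure S) E + ε / 2 + ε / 2 := by
          gcongr
          exact (measure_union_le _ _).trans (by gcongr)
      _ = (ν : Measure S) E + ε := by rw [add_assoc, ENNReal.add_halves]
  obtain ⟨W, hW, hU⟩ := hI.exists_seq_cover
  have hWm := fun n => hI.measurableSet _ (hW n)
  refine Measure.le_iff.2 fun E hE => ?_
  rw [measure_eq_tsum_inter_disjointed _ hWm hU hE, measure_eq_tsum_inter_disjointed _ hWm hU hE]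
  exact ENNReal.tsum_le_tsum fun n => hloc _ (hW n) _ (hE.inter (MeasurableSet.disjointed hWm n))
    (inter_subset_right.trans (disjointed_subset W n))

end IsCountableDissectingSemiring

/-! ### The embedding into `I → ℝ` -/

namespace LocFinMeasure

variable {S : Type*} [MetricSpace S] [MeasurableSpace S] {I : Set (Set S)}

/-- The values of a locally finite measure on a family of sets. -/
noncomputable def evalOn (I : Set (Set S)) (μ : LocFinMeasure S) : I → ℝ :=
  fun B => (μ : Measure S).real B

theorem evalOn_nonneg (μ : LocFinMeasure S) (B : I) : 0 ≤ evalOn I μ B := measureReal_nonneg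

theorem ofReal_evalOn (hI : IsCountableDissectingSemiring I) (μ : LocFinMeasure S) (B : I) :
    ENNReal.ofReal (evalOn I μ B) = (μ : Measure S) B :=
  ENNReal.ofReal_toReal (hI.measure_lt_top μ B.2).ne

/-- Masses of members of `I` are finite, so nothing is lost in passing to reals. This is what
carries upper sets of measures over to upper closures in `I → ℝ`. -/
theorem evalOn_le_evalOn_iff (hI : IsCountableDissectingSemiring I) {μ ν : LocFinMeasure S} :
    evalOn I μ ≤ evalOn I ν ↔ μ ≤ ν := by
  refine ⟨fun h => hI.le_of_forall_le fun B hB => ?_, fun h B => ?_⟩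
  · have := ENNReal.ofReal_le_ofReal (h ⟨B, hB⟩)
    rwa [ofReal_evalOn hI, ofReal_evalOn hI] at this
  · exact ENNReal.toReal_mono (hI.measure_lt_top ν B.2).ne (h B)

theorem measurable_apply {E : Set S} (hE : MeasurableSet E) :
    Measurable fun μ : LocFinMeasure S => (μ : Measure S) E :=
  (Measure.measurable_coe hE).comp measurable_subtype_coe

theorem measurable_evalOn (hI : IsCountableDissectingSemiring I) :
    Measurable (evalOn I : LocFinMeasure S → I → ℝ) :=
  measurable_pi_lambda _ fun B => (measurable_apply (hI.measurableSet B B.2)).ennreal_toReal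

/-- The `σ`-field on the space of locally finite measures is generated by the evaluations at
the members of the semiring. -/
theorem le_comap_evalOn (hI : IsCountableDissectingSemiring I) :
    (inferInstance : MeasurableSpace (LocFinMeasure S)) ≤
      MeasurableSpace.comap (evalOn I) inferInstance := by
  let m : MeasurableSpace (LocFinMeasure S) := MeasurableSpace.comap (evalOn I) inferInstance
  have hB : ∀ B ∈ I, Measurable[m] fun μ : LocFinMeasure S => (μ : Measure S) B := by
    intro B hB
    have h1 : Measurable[m] (evalOn I : LocFinMeasure S → I → ℝ) := comap_measurable _
    have h2 := ((measurable_pi_apply (⟨B, hB⟩ : I)).comp h1).ennreal_ofReal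
    convert h2 using 2 with μ
    exact (ofReal_evalOn hI μ ⟨B, hB⟩).symm
  -- The π-system argument needs finite measures, hence the restriction to `W`; a countable cover
  -- glues the pieces afterwards.
  have hloc : ∀ W ∈ I, Measurable[m] fun μ : LocFinMeasure S => (μ : Measure S).restrict W := by
    intro W hW
    have : ∀ μ : LocFinMeasure S, IsFiniteMeasure ((μ : Measure S).restrict W) := fun μ =>
      ⟨by simpa using hI.measure_lt_top μ hW⟩
    refine Measurable.measure_of_isPiSystem hI.generates.symm hI.isSetSemiring.isPiSystem ?_ ?_
    · intro B hBI
      simp_rw [Measure.restrict_apply (hI.measurableSet B hBI)]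
      exact hB _ (hI.isSetSemiring.inter_mem _ hBI _ hW)
    · simpa using hB W hW
  have hall : Measurable[m] fun μ : LocFinMeasure S => (μ : Measure S) := by
    refine Measure.measurable_of_measurable_coe _ fun E hE => ?_
    obtain ⟨W, hW, hU⟩ := hI.exists_seq_cover
    have hWm := fun n => hI.measurableSet _ (hW n)
    have : (fun μ : LocFinMeasure S => (μ : Measure S) E) = fun μ : LocFinMeasure S =>
        ∑' n, (μ : Measure S).restrict (W n) (E ∩ disjointed W n) := by
      ext μ
      rw [measure_eq_tsum_inter_disjointed _ hWm hU hE]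
      congr 1 with n
      rw [Measure.restrict_apply (hE.inter (MeasurableSet.disjointed hWm n)),
        inter_eq_left.2 (inter_subset_right.trans (disjointed_subset W n))]
    rw [this]
    have hterm : ∀ n, Measurable[m] fun μ : LocFinMeasure S =>
        (μ : Measure S).restrict (W n) (E ∩ disjointed W n) := fun n =>
      (Measure.measurable_coe (hE.inter (MeasurableSet.disjointed hWm n))).comp (hloc _ (hW n))
    exact Measurable.tsum hterm
  exact measurable_iff_comap_le.1 hall

end LocFinMeasure

/-! ### Tightness without local compactness -/

/-- Every countable cover of a member of `I` by members of `I` has a finite subfamily that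
covers the trace of that member on `K`. -/
def HasFiniteSubcovers {S : Type*} (I : Set (Set S)) (K : Set S) : Prop :=
  ∀ C : ℕ → Set S, (∀ n, C n ∈ I) → (⋃ n, C n) ∈ I →
    ∃ N, (⋃ n, C n) ∩ K ⊆ ⋃ n ∈ Finset.range N, C n

namespace IsCountableDissectingSemiring

variable {S : Type*} [MetricSpace S] [MeasurableSpace S] {I : Set (Set S)}

/-- Tightness of a finite measure with respect to sets with finite subcovers. -/
theorem exists_hasFiniteSubcovers [PolishSpace S] [BorelSpace S]
    (hI : IsCountableDissectingSemiring I) (ν : Measure S) [IsFiniteMeasure ν] {ε : ℝ≥0∞}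
    (hε : ε ≠ 0) : ∃ K, MeasurableSet K ∧ HasFiniteSubcovers I K ∧ ν Kᶜ < ε := by
  classical
  have : Countable I := hI.countable.to_subtype
  -- A point is encoded by the members of `I` containing it. The map is injective because the
  -- complement of a point is a union of members of `I`.
  let φ : S → I → Bool := fun x B => decide (x ∈ (B : Set S))
  have hφm : Measurable φ := by
    refine measurable_pi_lambda _ fun B => measurable_to_bool ?_
    convert hI.measurableSet B B.2 using 1
    ext x
    simp [φ]
  have hφi : Function.Injective φ := by
    intro x y hxy
    by_contra hne
    obtain ⟨C, hCI, -, hC⟩ := hI.topological {y}ᶜ isOpen_compl_singleton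
    have hx : x ∈ ({y}ᶜ : Set S) := hne
    rw [hC] at hx
    obtain ⟨B, hB, hxB⟩ := hx
    have hyB : y ∈ B := by
      have := congrFun hxy ⟨B, hCI hB⟩
      simpa [φ, hxB] using this
    have : y ∈ ({y}ᶜ : Set S) := hC ▸ mem_sUnion_of_mem hyB hB
    exact this rfl
  -- Lusin–Souslin: the range is Borel, so the compact set `K` below can be chosen inside it.
  have hφ : MeasurableEmbedding φ := hφm.measurableEmbedding hφi
  have hfin : IsFiniteMeasure (ν.map φ) := inferInstance
  obtain ⟨K, hK, hKc, hKε⟩ := hφ.measurableSet_range.exists_isCompact_sdiff_lt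
    (μ := ν.map φ) (measure_ne_top _ _) hε
  refine ⟨φ ⁻¹' K, hφm hKc.measurableSet, ?_, ?_⟩
  · intro C hC hU
    -- Each member of `I` is the preimage of a clopen cylinder, so a cover by members of `I` becomes
    -- an open cover of a compact set.
    let cyl : I → Set (I → Bool) := fun B => {y | y B = true}
    have hcyl : ∀ B, IsClopen (cyl B) := fun B =>
      (isClopen_discrete {true}).preimage (continuous_apply B)
    have hpre : ∀ B, φ ⁻¹' cyl B = B := fun B => by
      ext x
      simp [φ, cyl]
    have hcpt : IsCompact (cyl ⟨_, hU⟩ ∩ K) := hKc.inter_left (hcyl _).1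
    obtain ⟨t, ht⟩ := hcpt.elim_finite_subcover (fun n => cyl ⟨C n, hC n⟩)
      (fun n => (hcyl _).2) (by
        rintro y ⟨hy, hyK⟩
        obtain ⟨x, rfl⟩ := hK hyK
        have hx : x ∈ φ ⁻¹' cyl ⟨_, hU⟩ := hy
        rw [hpre] at hx
        obtain ⟨n, hn⟩ := mem_iUnion.1 hx
        refine mem_iUnion.2 ⟨n, ?_⟩
        change x ∈ φ ⁻¹' cyl ⟨C n, hC n⟩
        rw [hpre]
        exact hn)
    obtain ⟨N, hN⟩ := t.exists_nat_subset_range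
    refine ⟨N, fun x hx => ?_⟩
    have hx1 : φ x ∈ cyl ⟨_, hU⟩ := by
      change x ∈ φ ⁻¹' cyl ⟨_, hU⟩
      rw [hpre]
      exact hx.1
    obtain ⟨n, hn, hxn⟩ := mem_iUnion₂.1 (ht ⟨hx1, hx.2⟩)
    have hxn' : x ∈ φ ⁻¹' cyl ⟨C n, hC n⟩ := hxn
    rw [hpre] at hxn'
    exact mem_iUnion₂.2 ⟨n, hN hn, hxn'⟩
  · rw [Measure.map_apply hφm (hφ.measurableSet_range.diff hKc.measurableSet)] at hKε
    convert hKε using 2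
    ext x
    simp

end IsCountableDissectingSemiring

/-! ### Limits of tight families are measures -/

namespace LocFinMeasure

variable {S : Type*} [MetricSpace S] [MeasurableSpace S] {I : Set (Set S)}

/-- Limits of uniformly tight locally finite measures, in the topology of pointwise convergence
on the semiring, are locally finite measures. -/
theorem closure_image_evalOn_subset_range (hI : IsCountableDissectingSemiring I)
    (A : Set (LocFinMeasure S))
    (hA : ∀ B ∈ I, ∀ δ : ℝ, 0 < δ → ∃ K, MeasurableSet K ∧ HasFiniteSubcovers I K ∧
      ∀ μ ∈ A, (μ : Measure S).real (B \ K) ≤ δ) :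
    closure (evalOn I '' A) ⊆ range (evalOn I) := by
  classical
  intro x hx
  -- Closed conditions pass from evaluations of `A` to `x`. Non-negativity, finite additivity and
  -- finite subadditivity up to `δ` are all of this kind.
  have hclosed : ∀ p : (I → ℝ) → Prop, IsClosed {y | p y} → (∀ μ ∈ A, p (evalOn I μ)) → p x := by
    intro p hp h
    exact closure_minimal (image_subset_iff.2 h) hp hx
  have hx0 : ∀ B, 0 ≤ x B := fun B =>
    hclosed (fun y => 0 ≤ y B) (isClosed_le continuous_const (continuous_apply B))
      fun μ _ => evalOn_nonneg μ B
  let m₀ : Set S → ℝ := fun B => if h : B ∈ I then x ⟨B, h⟩ else 0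
  have hm₀ : ∀ B : I, m₀ B = x B := fun B => by simp [m₀]
  have hm₀0 : ∀ B, 0 ≤ m₀ B := fun B => by
    by_cases h : B ∈ I
    · simpa [m₀, h] using hx0 ⟨B, h⟩
    · simp [m₀, h]
  let m : AddContent ℝ≥0∞ I :=
    { toFun := fun B => ENNReal.ofReal (m₀ B)
      empty' := by
        have : x ⟨∅, hI.isSetSemiring.empty_mem⟩ = 0 :=
          hclosed (fun y => y ⟨∅, hI.isSetSemiring.empty_mem⟩ = 0)
            (isClosed_eq (continuous_apply _) continuous_const) fun μ _ => by simp [evalOn]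
        simp [m₀, hI.isSetSemiring.empty_mem, this]
      sUnion' := by
        intro J hJ hdis hU
        rw [← ENNReal.ofReal_sum_of_nonneg fun B _ => hm₀0 B]
        congr 1
        rw [← Finset.sum_attach]
        have hs : ∀ B : J, (B : Set S) ∈ I := fun B => hJ B.2
        have := hclosed (fun y => y ⟨⋃₀ J, hU⟩ = ∑ B ∈ J.attach, y ⟨B, hs B⟩)
          (isClosed_eq (continuous_apply _)
            (continuous_finsetSum _ fun B _ => continuous_apply _)) fun μ _ => by
            simp only [evalOn]
            rw [Finset.sum_attach J fun B => (μ : Measure S).real B, sUnion_eq_biUnion]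
            exact measureReal_biUnion_finset hdis (fun B hB => hI.measurableSet B (hJ hB))
              fun B hB => (hI.measure_lt_top μ (hJ hB)).ne
        rw [← hm₀ ⟨⋃₀ J, hU⟩] at this
        rw [this]
        exact Finset.sum_congr rfl fun B _ => (hm₀ ⟨B, hs B⟩).symm }
  have hmI : ∀ B : I, m B = ENNReal.ofReal (x B) := fun B => by
    change ENNReal.ofReal (m₀ B) = _
    rw [hm₀]
  have hsub : m.IsSigmaSubadditive := by
    intro C hC hU
    refine ENNReal.le_of_forall_pos_le_add fun δ hδ _ => ?_
    obtain ⟨K, hKm, hK, hKA⟩ := hA _ hU δ hδ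
    obtain ⟨N, hN⟩ := hK C hC hU
    -- On `K` finitely many of the `C n` suffice, and off `K` the mass is at most `δ` uniformly over
    -- `A`. Only finitely many coordinates occur, so the bound survives the limit.
    have hfin : x ⟨_, hU⟩ ≤ ∑ n ∈ Finset.range N, x ⟨C n, hC n⟩ + δ :=
      hclosed (fun y => y ⟨_, hU⟩ ≤ ∑ n ∈ Finset.range N, y ⟨C n, hC n⟩ + δ)
        (isClosed_le (continuous_apply _)
          ((continuous_finsetSum _ fun n _ => continuous_apply (⟨C n, hC n⟩ : I)).add
            continuous_const))
        fun μ hμ => by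
          simp only [evalOn]
          have hlt : ∀ s ⊆ ⋃ n, C n, (μ : Measure S) s ≠ ∞ := fun s hs =>
            ((measure_mono hs).trans_lt (hI.measure_lt_top μ hU)).ne
          have h1 : (μ : Measure S).real (⋃ n ∈ Finset.range N, C n) ≤
              ∑ n ∈ Finset.range N, (μ : Measure S).real (C n) :=
            measureReal_biUnion_finset_le _ _
          have h2 : (μ : Measure S).real (⋃ n, C n) ≤
              (μ : Measure S).real ((⋃ n ∈ Finset.range N, C n) ∪ ((⋃ n, C n) \ K)) := by
            refine measureReal_mono (fun y hy => ?_) (hlt _ ?_)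
            · by_cases hyK : y ∈ K
              · exact Or.inl (hN ⟨hy, hyK⟩)
              · exact Or.inr ⟨hy, hyK⟩
            · exact union_subset (iUnion₂_subset fun n _ => subset_iUnion C n) sdiff_subset
          have h3 := measureReal_union_le (μ := (μ : Measure S)) (⋃ n ∈ Finset.range N, C n)
            ((⋃ n, C n) \ K)
          have h4 := hKA μ hμ
          linarith
    calc m (⋃ n, C n) = ENNReal.ofReal (x ⟨_, hU⟩) := hmI ⟨_, hU⟩
      _ ≤ ENNReal.ofReal (∑ n ∈ Finset.range N, x ⟨C n, hC n⟩ + δ) :=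
          ENNReal.ofReal_le_ofReal hfin
      _ ≤ ENNReal.ofReal (∑ n ∈ Finset.range N, x ⟨C n, hC n⟩) + ENNReal.ofReal δ :=
          ENNReal.ofReal_add_le
      _ = ∑ n ∈ Finset.range N, m (C n) + δ := by
          rw [ENNReal.ofReal_sum_of_nonneg fun n _ => hx0 _, ENNReal.ofReal_coe_nnreal]
          congr 1
          exact Finset.sum_congr rfl fun n _ => (hmI ⟨C n, hC n⟩).symm
      _ ≤ ∑' n, m (C n) + δ := by
          gcongr
          exact ENNReal.sum_le_tsum _
  let ρ : Measure S := m.measure hI.isSetSemiring hI.generates.symm.le hsub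
  have hρ : ∀ B : I, ρ B = ENNReal.ofReal (x B) := fun B => by
    rw [← hmI]
    exact m.measure_eq hI.isSetSemiring hI.generates.symm hsub B.2
  refine ⟨⟨ρ, fun B _ hB => ?_⟩, ?_⟩
  -- The dissecting property gives finiteness on all bounded sets, not only on members of `I`.
  · obtain ⟨C, hCI, hC, hBC⟩ := hI.dissecting B hB
    refine (measure_mono hBC).trans_lt ?_
    rw [sUnion_eq_biUnion]
    refine measure_biUnion_lt_top hC fun D hD => ?_
    rw [hρ ⟨D, hCI hD⟩]
    exact ENNReal.ofReal_lt_top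
  · ext B
    simp only [evalOn, Measure.real, hρ]
    exact ENNReal.toReal_ofReal (hx0 B)

end LocFinMeasure

/-! ### A finite control measure for a random measure -/

/-- A random measure restricted to a set on which it is almost surely finite is small on sets
that are small for a suitable finite measure. -/
theorem MeasureTheory.exists_isFiniteMeasure_tendsto_inter_zero {Ω S : Type*} [MeasurableSpace Ω]
    [MeasurableSpace S] (P : Measure Ω) [IsFiniteMeasure P] {M : Ω → Measure S}
    (hM : Measurable M) {W : Set S} (hW : MeasurableSet W) (hMW : ∀ ω, M ω W ≠ ∞) :
    ∃ ν : Measure S, IsFiniteMeasure ν ∧ ∀ E : ℕ → Set S, (∀ n, MeasurableSet (E n)) →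
      ∑' n, ν (E n) ≠ ∞ → ∀ᵐ ω ∂P, Tendsto (fun n => M ω (E n ∩ W)) atTop (𝓝 0) := by
  have hMm : ∀ {E : Set S}, MeasurableSet E → Measurable fun ω => M ω E := fun hE =>
    (Measure.measurable_coe hE).comp hM
  -- The factor bounds the total mass by 1, so the mean of `κ` is finite even if `M ω W` is not
  -- integrable. Being positive and finite, the factor can be undone for each `ω`.
  let κ : Ω → Measure S := fun ω => (1 + M ω W)⁻¹ • (M ω).restrict W
  have hκE : ∀ {E : Set S}, MeasurableSet E → ∀ ω, κ ω E = (1 + M ω W)⁻¹ * M ω (E ∩ W) := by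
    intro E hE ω
    simp [κ, Measure.restrict_apply hE]
  have hκ : Measurable κ := by
    refine Measure.measurable_of_measurable_coe _ fun E hE => ?_
    simp_rw [hκE hE]
    exact ((hMm hW).const_add 1).inv.mul (hMm (hE.inter hW))
  have hν : ∀ {E : Set S}, MeasurableSet E →
      P.bind κ E = ∫⁻ ω, (1 + M ω W)⁻¹ * M ω (E ∩ W) ∂P := by
    intro E hE
    rw [Measure.bind_apply hE hκ.aemeasurable]
    simp_rw [hκE hE]
  refine ⟨P.bind κ, ⟨?_⟩, fun E hE hsum => ?_⟩
  · rw [hν MeasurableSet.univ]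
    refine lt_of_le_of_lt (lintegral_mono (g := fun _ => 1) fun ω => ?_) (by simp)
    rw [univ_inter]
    calc (1 + M ω W)⁻¹ * M ω W ≤ (1 + M ω W)⁻¹ * (1 + M ω W) := by
          gcongr
          exact le_add_self
      _ ≤ 1 := ENNReal.inv_mul_le_one _
  · have hmeas : ∀ n, Measurable fun ω => (1 + M ω W)⁻¹ * M ω (E n ∩ W) := fun n =>
      ((hMm hW).const_add 1).inv.mul (hMm ((hE n).inter hW))
    simp_rw [hν (hE _)] at hsum
    rw [← lintegral_tsum fun n => (hmeas n).aemeasurable] at hsum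
    filter_upwards [ae_lt_top (Measurable.tsum hmeas) hsum] with ω hω
    have h0 := ENNReal.tendsto_atTop_zero_of_tsum_ne_top hω.ne
    have hne : 1 + M ω W ≠ 0 := by simp
    have hnt : 1 + M ω W ≠ ∞ := by simp [hMW ω]
    have h1 := ENNReal.Tendsto.const_mul (a := 1 + M ω W) h0 (Or.inr hnt)
    simpa [← mul_assoc, ENNReal.mul_inv_cancel hne hnt] using h1

/-! ### Monotone cylinder functions -/

/-- A continuous, coordinatewise non-decreasing function of finitely many coordinates. -/
structure IsMonotoneCylinder {ι : Type*} (h : (ι → ℝ) → ℝ) : Prop where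
  continuous : Continuous h
  monotone : Monotone h
  dependsOn : ∃ F : Finset ι, DependsOn h (F : Set ι)

namespace IsMonotoneCylinder

variable {ι : Type*}

theorem const (c : ℝ) : IsMonotoneCylinder fun _ : ι → ℝ => c :=
  ⟨continuous_const, monotone_const, ∅, fun _ _ _ => rfl⟩

theorem add {h k : (ι → ℝ) → ℝ} (hh : IsMonotoneCylinder h) (hk : IsMonotoneCylinder k) :
    IsMonotoneCylinder fun x => h x + k x := by
  classical
  obtain ⟨F, hF⟩ := hh.dependsOn
  obtain ⟨G, hG⟩ := hk.dependsOn
  refine ⟨hh.continuous.add hk.continuous, hh.monotone.add hk.monotone, F ∪ G, fun x y hxy => ?_⟩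
  exact congrArg₂ (· + ·) (hF fun i hi => hxy i (by simp [Finset.mem_coe.1 hi]))
    (hG fun i hi => hxy i (by simp [Finset.mem_coe.1 hi]))

theorem const_mul {h : (ι → ℝ) → ℝ} (hh : IsMonotoneCylinder h) {c : ℝ} (hc : 0 ≤ c) :
    IsMonotoneCylinder fun x => c * h x := by
  obtain ⟨F, hF⟩ := hh.dependsOn
  exact ⟨hh.continuous.const_mul c, hh.monotone.const_mul hc, F,
    fun x y hxy => congrArg (c * ·) (hF hxy)⟩

theorem sum {κ : Type*} (s : Finset κ) {h : κ → (ι → ℝ) → ℝ}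
    (hh : ∀ k ∈ s, IsMonotoneCylinder (h k)) : IsMonotoneCylinder fun x => ∑ k ∈ s, h k x := by
  classical
  induction s using Finset.induction with
  | empty => simpa using const 0
  | insert k s hk ih =>
    simp_rw [Finset.sum_insert hk]
    exact (hh k (by simp)).add (ih fun j hj => hh j (by simp [hj]))

/-- The indicator of the upper closure of a compact set is a pointwise limit of continuous
non-decreasing functions of finitely many coordinates. -/
theorem exists_tendsto_indicator_upperClosure [Countable ι] {L : Set (ι → ℝ)}
    (hL : IsCompact L) :
    ∃ h : ℕ → (ι → ℝ) → ℝ, (∀ n, IsMonotoneCylinder (h n)) ∧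
      (∀ n x, h n x ∈ Icc (0 : ℝ) 1) ∧
      ∀ x, Tendsto (fun n => h n x) atTop
        (𝓝 ((upperClosure L : Set (ι → ℝ)).indicator (fun _ => (1 : ℝ)) x)) := by
  classical
  -- For empty `L` the infimum below would default to 0 and the approximants to 1.
  rcases L.eq_empty_or_nonempty with rfl | hne
  · exact ⟨fun _ _ => 0, fun _ => const 0, by simp, by simp⟩
  -- A one-sided distance: it vanishes exactly when `y ≤ x` on `F`. Its minimum `g` over `L` is
  -- non-increasing in `x`.
  let d : Finset ι → (ι → ℝ) → (ι → ℝ) → ℝ := fun F x y => ∑ i ∈ F, max (y i - x i) 0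
  let g : Finset ι → (ι → ℝ) → ℝ := fun F x => sInf (d F x '' L)
  have hdcont : ∀ F, Continuous ↿(d F) := fun F => by
    refine continuous_finsetSum _ fun i _ => ?_
    exact (((continuous_apply i).comp continuous_snd).sub
      ((continuous_apply i).comp continuous_fst)).max continuous_const
  have hdcont' : ∀ F x, Continuous (d F x) := fun F x => (hdcont F).comp (.prodMk_right x)
  have hd0 : ∀ F x y, 0 ≤ d F x y := fun F x y => Finset.sum_nonneg fun i _ => le_max_right _ _
  have hg0 : ∀ F x, 0 ≤ g F x := fun F x =>
    Real.sInf_nonneg (by rintro _ ⟨y, -, rfl⟩; exact hd0 F x y)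
  have hbdd : ∀ F x, BddBelow (d F x '' L) := fun F x =>
    ⟨0, by rintro _ ⟨y, -, rfl⟩; exact hd0 F x y⟩
  have hmin : ∀ F x, ∃ y ∈ L, g F x = d F x y := fun F x =>
    hL.exists_sInf_image_eq hne (hdcont' F x).continuousOn
  have hganti : ∀ F, Antitone (g F) := by
    intro F x x' hxx'
    obtain ⟨y, hy, hxy⟩ := hmin F x
    rw [hxy]
    refine (csInf_le (hbdd F x') (mem_image_of_mem _ hy)).trans ?_
    exact Finset.sum_le_sum fun i _ => max_le_max (sub_le_sub_left (hxx' i) _) le_rfl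
  have hgmono : ∀ x, Monotone fun F => g F x := by
    intro x F F' hFF'
    obtain ⟨y, hy, hxy⟩ := hmin F' x
    change g F x ≤ g F' x
    rw [hxy]
    refine (csInf_le (hbdd F x) (mem_image_of_mem _ hy)).trans ?_
    exact Finset.sum_le_sum_of_subset_of_nonneg hFF' fun i _ _ => le_max_right _ _
  have hgdep : ∀ F : Finset ι, DependsOn (g F) (F : Set ι) := by
    intro F x x' hxx'
    have : d F x = d F x' := by
      ext y
      exact Finset.sum_congr rfl fun i hi => by rw [hxx' i hi]
    simp only [g, this]
  obtain ⟨F, -, hF⟩ := exists_seq_monotone_tendsto_atTop_atTop (Finset ι)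
  refine ⟨fun n x => max (1 - n * g (F n) x) 0, fun n => ⟨?_, ?_, F n, ?_⟩, fun n x => ⟨?_, ?_⟩,
    fun x => ?_⟩
  · exact (continuous_const.sub (continuous_const.mul (hL.continuous_sInf (hdcont _)))).max
      continuous_const
  · intro x x' hxx'
    have := mul_le_mul_of_nonneg_left (hganti (F n) hxx') n.cast_nonneg
    exact max_le_max (by linarith) le_rfl
  · intro x x' hxx'
    simp only [hgdep (F n) hxx']
  · exact le_max_right _ _
  · have := mul_nonneg (n.cast_nonneg (α := ℝ)) (hg0 (F n) x)
    exact max_le (by linarith) zero_le_one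
  · by_cases hx : x ∈ (upperClosure L : Set (ι → ℝ))
    · rw [indicator_of_mem hx]
      obtain ⟨y, hy, hyx⟩ := mem_upperClosure.1 hx
      have hzero : ∀ F, g F x = 0 := fun F => by
        refine le_antisymm ((csInf_le (hbdd F x) (mem_image_of_mem _ hy)).trans ?_) (hg0 F x)
        exact Finset.sum_nonpos fun i _ => max_le (sub_nonpos.2 (hyx i)) le_rfl
      simp [hzero]
    · rw [indicator_of_notMem hx]
      have hlt : ∀ y ∈ L, ∃ i, x i < y i := fun y hy => by
        by_contra! h
        exact hx (mem_upperClosure.2 ⟨y, hy, h⟩)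
      -- Compactness: finitely many coordinates already witness that `x` lies above no point of `L`,
      -- so `g G x` is positive and the slope `n` eventually brings the ramp to 0.
      obtain ⟨G, hG⟩ := hL.elim_finite_subcover (fun i => {y : ι → ℝ | x i < y i})
        (fun i => isOpen_lt continuous_const (continuous_apply i))
        fun y hy => mem_iUnion.2 (hlt y hy)
      have hpos : 0 < g G x := by
        obtain ⟨y, hy, hxy⟩ := hmin G x
        obtain ⟨i, hi, hxi⟩ := mem_iUnion₂.1 (hG hy)
        rw [hxy]
        refine Finset.sum_pos' (fun i _ => le_max_right _ _) ⟨i, hi, ?_⟩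
        exact lt_max_of_lt_left (sub_pos.2 hxi)
      refine tendsto_const_nhds.congr' ?_
      filter_upwards [hF.eventually_ge_atTop G,
        (tendsto_natCast_atTop_atTop (R := ℝ)).eventually_ge_atTop (1 / g G x)] with n hn hn'
      have h1 : 1 ≤ n * g G x := (div_le_iff₀ hpos).1 hn'
      have h2 := mul_le_mul_of_nonneg_left (hgmono x hn) (n.cast_nonneg (α := ℝ))
      exact (max_eq_right (by simp only at h2; linarith)).symm

end IsMonotoneCylinder

/-! ### Compact sets of measures and increasing events -/

namespace LocFinMeasure

variable {S Ω : Type*} [MetricSpace S] [MeasurableSpace S] [MeasurableSpace Ω] {I : Set (Set S)}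

/-- Tightness of the restriction of a random measure to a member of the semiring. -/
theorem exists_hasFiniteSubcovers_measure_lt [PolishSpace S] [BorelSpace S]
    (hI : IsCountableDissectingSemiring I) (P : Measure Ω) [IsFiniteMeasure P]
    {M : Ω → LocFinMeasure S} (hM : Measurable M) {B : Set S} (hB : B ∈ I) {δ : ℝ} (hδ : 0 < δ)
    {ε : ℝ≥0∞} (hε : 0 < ε) :
    ∃ K, MeasurableSet K ∧ HasFiniteSubcovers I K ∧
      P {ω | δ ≤ (M ω : Measure S).real (B \ K)} < ε := by
  have hBm := hI.measurableSet B hB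
  obtain ⟨ν, hν, hνM⟩ := exists_isFiniteMeasure_tendsto_inter_zero P
    (measurable_subtype_coe.comp hM) hBm fun ω => (hI.measure_lt_top (M ω) hB).ne
  obtain ⟨u, hu, hsum⟩ := ENNReal.exists_pos_sum_of_countable' one_ne_zero ℕ
  choose K hKm hK hKν using fun n => hI.exists_hasFiniteSubcovers ν (hu n).ne'
  have hsum' : ∑' n, ν (K n)ᶜ ≠ ∞ :=
    ((ENNReal.tsum_le_tsum fun n => (hKν n).le).trans_lt (hsum.trans ENNReal.one_lt_top)).ne
  have hlim := hνM (fun n => (K n)ᶜ) (fun n => (hKm n).compl) hsum'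
  have hmeas : TendstoInMeasure P (fun n ω => (M ω : Measure S).real (B \ K n)) atTop
      fun _ => 0 := by
    refine tendstoInMeasure_of_tendsto_ae (fun n => ?_) ?_
    · exact ((measurable_apply (hBm.diff (hKm n))).comp hM).ennreal_toReal.aestronglyMeasurable
    · filter_upwards [hlim] with ω hω
      have := (ENNReal.tendsto_toReal ENNReal.zero_ne_top).comp hω
      simpa [Function.comp_def, sdiff_eq, inter_comm, Measure.real] using this
  obtain ⟨n, hn⟩ := ((tendstoInMeasure_iff_norm.1 hmeas δ hδ).eventually (gt_mem_nhds hε)).exists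
  refine ⟨K n, hKm n, hK n, ?_⟩
  simpa [abs_of_nonneg measureReal_nonneg] using hn

/-- The law of a random measure is tight on the space of values on the semiring, with compact
sets of genuine measures. -/
theorem exists_isCompact_subset_range_evalOn [PolishSpace S] [BorelSpace S]
    (hI : IsCountableDissectingSemiring I) (P : Measure Ω) [IsFiniteMeasure P]
    {M : Ω → LocFinMeasure S} (hM : Measurable M) {ε : ℝ≥0∞} (hε : ε ≠ 0) :
    ∃ T : Set (I → ℝ), IsCompact T ∧ T ⊆ range (evalOn I) ∧ P {ω | evalOn I (M ω) ∉ T} < ε := by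
  have : Countable I := hI.countable.to_subtype
  have hε2 : ε / 2 ≠ 0 := (ENNReal.half_pos hε).ne'
  have hXm : Measurable fun ω => evalOn I (M ω) := (measurable_evalOn hI).comp hM
  obtain ⟨L, -, hL, hLε⟩ := (MeasurableSet.univ (α := I → ℝ)).exists_isCompact_sdiff_lt
    (μ := P.map fun ω => evalOn I (M ω)) (measure_ne_top _ _) hε2
  rw [Measure.map_apply hXm (MeasurableSet.univ.diff hL.measurableSet)] at hLε
  -- Half of `ε` pays for leaving `L`; the other half is spread over all pairs of a member of `I`
  -- and a threshold `1 / (n + 1)`.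
  obtain ⟨u, hu, hsum⟩ := ENNReal.exists_pos_sum_of_countable' hε2 (I × ℕ)
  choose K hKm hK hKP using fun p : I × ℕ =>
    exists_hasFiniteSubcovers_measure_lt hI P hM p.1.2 (Nat.one_div_pos_of_nat (α := ℝ) (n := p.2))
      (hu p)
  let A : Set (LocFinMeasure S) := {μ | evalOn I μ ∈ L ∧
    ∀ p : I × ℕ, (μ : Measure S).real (p.1 \ K p) < 1 / (p.2 + 1 : ℝ)}
  have hAL : closure (evalOn I '' A) ⊆ L :=
    closure_minimal (image_subset_iff.2 fun μ hμ => hμ.1) hL.isClosed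
  refine ⟨closure (evalOn I '' A), hL.of_isClosed_subset isClosed_closure hAL, ?_, ?_⟩
  · refine closure_image_evalOn_subset_range hI A fun B hB δ hδ => ?_
    obtain ⟨n, hn⟩ := exists_nat_one_div_lt hδ
    exact ⟨K (⟨B, hB⟩, n), hKm _, hK _, fun μ hμ => ((hμ.2 (⟨B, hB⟩, n)).trans hn).le⟩
  · calc P {ω | evalOn I (M ω) ∉ closure (evalOn I '' A)}
        ≤ P ((fun ω => evalOn I (M ω)) ⁻¹' (univ \ L) ∪
            ⋃ p : I × ℕ, {ω | 1 / (p.2 + 1 : ℝ) ≤ (M ω : Measure S).real (p.1 \ K p)}) := by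
          refine measure_mono fun ω hω => ?_
          by_contra hcon
          simp only [mem_union, mem_preimage, Set.mem_sdiff, mem_univ, true_and, mem_iUnion,
            mem_ofPred_eq, not_or, not_not, not_exists, not_le] at hcon
          exact hω (subset_closure ⟨M ω, ⟨hcon.1, hcon.2⟩, rfl⟩)
      _ ≤ P ((fun ω => evalOn I (M ω)) ⁻¹' (univ \ L)) + ∑' p : I × ℕ,
            P {ω | 1 / (p.2 + 1 : ℝ) ≤ (M ω : Measure S).real (p.1 \ K p)} :=
          (measure_union_le _ _).trans (by gcongr; exact measure_iUnion_le _)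
      _ < ε / 2 + ε / 2 := by
          refine ENNReal.add_lt_add hLε ?_
          exact (ENNReal.tsum_le_tsum fun p => (hKP p).le).trans_lt hsum
      _ = ε := ENNReal.add_halves ε

/-- Increasing events are approximated by continuous increasing cylinder functions. -/
theorem exists_isMonotoneCylinder_indicator [PolishSpace S] [BorelSpace S]
    (hI : IsCountableDissectingSemiring I) (P : Measure Ω) [IsFiniteMeasure P]
    {M : Ω → LocFinMeasure S} (hM : Measurable M) {U : Set (LocFinMeasure S)}
    (hU : MeasurableSet U) (hUu : IsUpperSet U) {ε : ℝ} (hε : 0 < ε) :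
    ∃ h : (I → ℝ) → ℝ, IsMonotoneCylinder h ∧ (∀ x, h x ∈ Icc (0 : ℝ) 1) ∧
      ∫ ω, |U.indicator (fun _ => (1 : ℝ)) (M ω) - h (evalOn I (M ω))| ∂P < ε := by
  have : Countable I := hI.countable.to_subtype
  have hXm : Measurable fun ω => evalOn I (M ω) := (measurable_evalOn hI).comp hM
  obtain ⟨V, hV, rfl⟩ := le_comap_evalOn hI _ hU
  have hε2 : ENNReal.ofReal (ε / 2) ≠ 0 := by simpa using hε
  have hε4 : ENNReal.ofReal (ε / 2) / 2 ≠ 0 := (ENNReal.half_pos hε2).ne'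
  obtain ⟨T, hT, hTr, hTP⟩ := exists_isCompact_subset_range_evalOn hI P hM hε4
  obtain ⟨L₀, hL₀V, hL₀, hL₀P⟩ := hV.exists_isCompact_sdiff_lt
    (μ := P.map fun ω => evalOn I (M ω)) (measure_ne_top _ _) hε4
  rw [Measure.map_apply hXm (hV.diff hL₀.measurableSet)] at hL₀P
  -- Points of `T` are evaluations of measures. Hence an evaluation above a point of `L` belongs to
  -- a measure above one in the upper set, although `V` itself need not be an upper set.
  let L := L₀ ∩ T
  have hL : IsCompact L := hL₀.inter hT
  obtain ⟨h, hcyl, hh01, hlim⟩ := IsMonotoneCylinder.exists_tendsto_indicator_upperClosure hL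
  let f : Ω → ℝ := fun ω => (evalOn I ⁻¹' V).indicator (fun _ => (1 : ℝ)) (M ω)
  let k : Ω → ℝ := fun ω =>
    (upperClosure L : Set (I → ℝ)).indicator (fun _ => (1 : ℝ)) (evalOn I (M ω))
  have hf : Measurable f := (measurable_const.indicator hU).comp hM
  have hf01 : ∀ ω, f ω ∈ Icc (0 : ℝ) 1 := fun ω => by
    by_cases hω : M ω ∈ evalOn I ⁻¹' V <;> simp [f, indicator, hω]
  have hconv : Tendsto (fun n => ∫ ω, |f ω - h n (evalOn I (M ω))| ∂P) atTop
      (𝓝 (∫ ω, |f ω - k ω| ∂P)) := by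
    refine tendsto_integral_of_dominated_convergence (fun _ => 1) (fun n => ?_)
      (integrable_const _) (fun n => ?_) ?_
    · exact (hf.sub ((hcyl n).continuous.measurable.comp hXm)).abs.aestronglyMeasurable
    · refine .of_forall fun ω => ?_
      have h1 := hf01 ω
      have h2 := hh01 n (evalOn I (M ω))
      simp only [Real.norm_eq_abs, abs_abs]
      exact abs_le.2 ⟨by linarith [h1.1, h2.2], by linarith [h1.2, h2.1]⟩
    · exact .of_forall fun ω => (tendsto_const_nhds.sub (hlim (evalOn I (M ω)))).abs
  have hbound : ∫ ω, |f ω - k ω| ∂P ≤ ε / 2 := by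
    let D : Set Ω := (fun ω => evalOn I (M ω)) ⁻¹' (V \ L₀) ∪ {ω | evalOn I (M ω) ∉ T}
    have hDm : MeasurableSet D :=
      (hXm (hV.diff hL₀.measurableSet)).union (hXm hT.measurableSet).compl
    have hDP : P D ≤ ENNReal.ofReal (ε / 2) := by
      refine (measure_union_le _ _).trans ?_
      exact (add_le_add hL₀P.le hTP.le).trans_eq (ENNReal.add_halves _)
    have hle : ∀ ω, |f ω - k ω| ≤ D.indicator (fun _ => (1 : ℝ)) ω := by
      intro ω
      by_cases hk : evalOn I (M ω) ∈ (upperClosure L : Set (I → ℝ))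
      · have hfV : M ω ∈ evalOn I ⁻¹' V := by
          obtain ⟨y, hy, hyM⟩ := mem_upperClosure.1 hk
          obtain ⟨μ, rfl⟩ := hTr hy.2
          exact hUu ((evalOn_le_evalOn_iff hI).1 hyM) (hL₀V hy.1)
        have : |f ω - k ω| = 0 := by
          simp only [f, k, indicator_of_mem hfV, indicator_of_mem hk, sub_self, abs_zero]
        rw [this]
        exact indicator_nonneg (fun _ _ => zero_le_one) _
      · have hk0 : k ω = 0 := indicator_of_notMem hk _
        by_cases hfV : M ω ∈ evalOn I ⁻¹' V
        · have hωD : ω ∈ D := by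
            by_contra hcon
            simp only [D, mem_union, mem_preimage, Set.mem_sdiff, mem_ofPred_eq, not_or, not_and,
              not_not] at hcon
            exact hk (subset_upperClosure ⟨hcon.1 hfV, hcon.2⟩)
          rw [indicator_of_mem hωD, hk0, sub_zero, abs_of_nonneg (hf01 ω).1]
          exact (hf01 ω).2
        · have hf0 : f ω = 0 := indicator_of_notMem hfV _
          rw [hf0, hk0, sub_zero, abs_zero]
          exact indicator_nonneg (fun _ _ => zero_le_one) _
    calc ∫ ω, |f ω - k ω| ∂P ≤ ∫ ω, D.indicator (fun _ => (1 : ℝ)) ω ∂P :=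
          integral_mono_of_nonneg (.of_forall fun ω => abs_nonneg _)
            ((integrable_const _).indicator hDm) (.of_forall hle)
      _ = P.real D := by simp [integral_indicator hDm]
      _ ≤ ε / 2 := ENNReal.toReal_le_of_le_ofReal (by linarith) hDP
  obtain ⟨n, hn⟩ := (hconv.eventually (gt_mem_nhds (hbound.trans_lt (half_lt_self hε)))).exists
  exact ⟨h n, hcyl n, hh01 n, hn⟩

end LocFinMeasure

/-! ### From increasing events to increasing functionals -/

/-- Coordinates outside `F` do not affect `h` and may be replaced by those of the limit; convergence
on `F` then becomes convergence in the product topology. -/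
theorem IsMonotoneCylinder.tendsto {ι : Type*} {h : (ι → ℝ) → ℝ} (hh : IsMonotoneCylinder h)
    {F : Finset ι} (hF : DependsOn h (F : Set ι)) {x : ℕ → ι → ℝ} {y : ι → ℝ}
    (hx : ∀ i ∈ F, Tendsto (fun n => x n i) atTop (𝓝 (y i))) :
    Tendsto (fun n => h (x n)) atTop (𝓝 (h y)) := by
  classical
  have h1 : ∀ n, h (x n) = h fun i => if i ∈ F then x n i else y i := fun n =>
    hF fun i hi => (if_pos (Finset.mem_coe.1 hi)).symm
  simp_rw [h1]
  refine (hh.continuous.tendsto y).comp (tendsto_pi_nhds.2 fun i => ?_)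
  by_cases hi : i ∈ F
  · simpa [hi] using hx i hi
  · simp [hi]

/-- The sum counts the positive integers up to `n * t`, so it equals `⌊n * t⌋₊`; the cut-off at `n`
is harmless since `t ≤ 1`. The steps later become indicators of superlevel sets. -/
theorem abs_sub_staircase_le {t : ℝ} (ht : t ∈ Icc (0 : ℝ) 1) {n : ℕ} (hn : 0 < n) :
    |t - 1 / n * ∑ k ∈ Finset.Icc 1 n, (if (k : ℝ) ≤ n * t then (1 : ℝ) else 0)| ≤ 1 / n := by
  have hn' : (0 : ℝ) < n := by exact_mod_cast hn
  have hnt : 0 ≤ n * t := mul_nonneg hn'.le ht.1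
  have hset : (Finset.Icc 1 n).filter (fun k : ℕ => (k : ℝ) ≤ n * t) =
      Finset.Icc 1 ⌊(n : ℝ) * t⌋₊ := by
    ext k
    simp only [Finset.mem_filter, Finset.mem_Icc, Nat.le_floor_iff hnt]
    constructor
    · rintro ⟨⟨h1, -⟩, h2⟩
      exact ⟨h1, h2⟩
    · rintro ⟨h1, h2⟩
      refine ⟨⟨h1, ?_⟩, h2⟩
      have : (k : ℝ) ≤ n := h2.trans (mul_le_of_le_one_right hn'.le ht.2)
      exact_mod_cast this
  rw [Finset.sum_ite, Finset.sum_const_zero, add_zero, Finset.sum_const, hset, Nat.card_Icc,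
    nsmul_eq_mul, mul_one, Nat.add_sub_cancel]
  have h1 := Nat.floor_le hnt
  have h2 := Nat.lt_floor_add_one ((n : ℝ) * t)
  have h3 : t - 1 / n * (⌊(n : ℝ) * t⌋₊ : ℝ) = (n * t - ⌊(n : ℝ) * t⌋₊) / n := by
    field_simp
  rw [h3, abs_of_nonneg (div_nonneg (by linarith) hn'.le)]
  gcongr
  linarith

/-- Non-positive correlation is stable under bounded approximation in mean. -/
theorem integral_mul_le_of_forall_approx {Ω : Type*} [MeasurableSpace Ω] (P : Measure Ω)
    [IsProbabilityMeasure P] {X Y : Ω → ℝ} {C : ℝ} (hX : Measurable X) (hY : Measurable Y)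
    (hXC : ∀ ω, |X ω| ≤ C) (hYC : ∀ ω, |Y ω| ≤ C)
    (h : ∀ ε > 0, ∃ X' Y' : Ω → ℝ, Measurable X' ∧ Measurable Y' ∧ (∀ ω, |X' ω| ≤ C) ∧
      (∀ ω, |Y' ω| ≤ C) ∧ ∫ ω, |X ω - X' ω| ∂P < ε ∧ ∫ ω, |Y ω - Y' ω| ∂P < ε ∧
      ∫ ω, X' ω * Y' ω ∂P ≤ (∫ ω, X' ω ∂P) * ∫ ω, Y' ω ∂P) :
    ∫ ω, X ω * Y ω ∂P ≤ (∫ ω, X ω ∂P) * ∫ ω, Y ω ∂P := by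
  obtain ⟨ω₀⟩ : Nonempty Ω := P.nonempty_of_neZero
  have hC : 0 ≤ C := (abs_nonneg _).trans (hXC ω₀)
  have hint : ∀ {Z : Ω → ℝ} {K : ℝ}, Measurable Z → (∀ ω, |Z ω| ≤ K) → Integrable Z P :=
    fun hZ hK => Integrable.of_bound hZ.aestronglyMeasurable _ (.of_forall hK)
  have habs : ∀ {Z : Ω → ℝ}, (∀ ω, |Z ω| ≤ C) → |∫ ω, Z ω ∂P| ≤ C := fun {Z} hZ => by
    have := norm_integral_le_of_norm_le_const (μ := P) (f := Z) (.of_forall hZ)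
    simpa using this
  refine le_of_forall_pos_le_add fun ε hε => ?_
  -- Replacing both factors costs `2 * C * η` in the mean of the product and as much in the product
  -- of the means. The `+ 1` covers `C = 0`.
  have hη : 0 < ε / (4 * C + 1) := by positivity
  obtain ⟨X', Y', hX', hY', hXC', hYC', hXX', hYY', hcov⟩ := h _ hη
  set η := ε / (4 * C + 1)
  have hηC : 4 * C * η ≤ ε := by
    have : (4 * C + 1) * η = ε := mul_div_cancel₀ _ (by positivity)
    linarith
  have hmulC : ∀ {a b : ℝ}, |a| ≤ C → |b| ≤ C → |a * b| ≤ C * C := fun ha hb => by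
    rw [abs_mul]
    exact mul_le_mul ha hb (abs_nonneg _) hC
  have iX := hint hX hXC
  have iY := hint hY hYC
  have iX' := hint hX' hXC'
  have iY' := hint hY' hYC'
  have iXY : Integrable (fun ω => X ω * Y ω) P :=
    hint (hX.mul hY) fun ω => hmulC (hXC ω) (hYC ω)
  have iXY' : Integrable (fun ω => X' ω * Y' ω) P :=
    hint (hX'.mul hY') fun ω => hmulC (hXC' ω) (hYC' ω)
  have iXd : Integrable (fun ω => C * |X ω - X' ω|) P := (iX.sub iX').abs.const_mul C
  have iYd : Integrable (fun ω => C * |Y ω - Y' ω|) P := (iY.sub iY').abs.const_mul C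
  have e1 : ∫ ω, X ω * Y ω ∂P - ∫ ω, X' ω * Y' ω ∂P ≤ C * η + C * η := by
    rw [← integral_sub iXY iXY']
    calc ∫ ω, (X ω * Y ω - X' ω * Y' ω) ∂P
        ≤ ∫ ω, (C * |X ω - X' ω| + C * |Y ω - Y' ω|) ∂P := by
          refine integral_mono (iXY.sub iXY') (iXd.add iYd) fun ω => ?_
          have h1 : (X ω - X' ω) * Y ω ≤ |X ω - X' ω| * C := by
            refine (le_abs_self _).trans ?_
            rw [abs_mul]
            gcongr
            exact hYC ω
          have h2 : X' ω * (Y ω - Y' ω) ≤ C * |Y ω - Y' ω| := by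
            refine (le_abs_self _).trans ?_
            rw [abs_mul]
            gcongr
            exact hXC' ω
          change X ω * Y ω - X' ω * Y' ω ≤ C * |X ω - X' ω| + C * |Y ω - Y' ω|
          linarith
      _ = C * ∫ ω, |X ω - X' ω| ∂P + C * ∫ ω, |Y ω - Y' ω| ∂P := by
          rw [integral_add iXd iYd, integral_const_mul, integral_const_mul]
      _ ≤ C * η + C * η := by gcongr
  have e2 : |∫ ω, X ω ∂P - ∫ ω, X' ω ∂P| ≤ η := by
    rw [← integral_sub iX iX']
    exact (abs_integral_le_integral_abs).trans hXX'.le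
  have e3 : |∫ ω, Y ω ∂P - ∫ ω, Y' ω ∂P| ≤ η := by
    rw [← integral_sub iY iY']
    exact (abs_integral_le_integral_abs).trans hYY'.le
  have h1 : (∫ ω, X' ω ∂P - ∫ ω, X ω ∂P) * ∫ ω, Y' ω ∂P ≤ η * C := by
    refine (le_abs_self _).trans ?_
    rw [abs_mul, abs_sub_comm]
    exact mul_le_mul e2 (habs hYC') (abs_nonneg _) hη.le
  have h2 : (∫ ω, X ω ∂P) * (∫ ω, Y' ω ∂P - ∫ ω, Y ω ∂P) ≤ C * η := by
    refine (le_abs_self _).trans ?_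
    rw [abs_mul, abs_sub_comm (∫ ω, Y' ω ∂P)]
    exact mul_le_mul (habs hXC) e3 (abs_nonneg _) hC
  nlinarith

namespace LocFinMeasure

variable {S Ω : Type*} [MetricSpace S] [MeasurableSpace S] [MeasurableSpace Ω] {I : Set (Set S)}

/-- Bounded increasing functionals of a random measure are approximated in mean by continuous
increasing cylinder functions. -/
theorem exists_isMonotoneCylinder_approx [PolishSpace S] [BorelSpace S]
    (hI : IsCountableDissectingSemiring I) (P : Measure Ω) [IsProbabilityMeasure P]
    {M : Ω → LocFinMeasure S} (hM : Measurable M) {f : LocFinMeasure S → ℝ} (hf : Measurable f)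
    (hfm : Monotone f) {C : ℝ} (hC : 0 < C) (hfC : ∀ μ, |f μ| ≤ C) {ε : ℝ} (hε : 0 < ε) :
    ∃ h : (I → ℝ) → ℝ, IsMonotoneCylinder h ∧ (∀ x, |h x| ≤ C) ∧
      ∫ ω, |f (M ω) - h (evalOn I (M ω))| ∂P < ε := by
  have : Countable I := hI.countable.to_subtype
  have hXm : Measurable fun ω => evalOn I (M ω) := (measurable_evalOn hI).comp hM
  let f₀ : LocFinMeasure S → ℝ := fun μ => (f μ + C) / (2 * C)
  have hf₀ : ∀ μ, f₀ μ ∈ Icc (0 : ℝ) 1 := fun μ => by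
    have := abs_le.1 (hfC μ)
    exact ⟨div_nonneg (by linarith) (by linarith), (div_le_one (by linarith)).2 (by linarith)⟩
  -- After rescaling by `2 * C`, the staircase error is below `ε / 2`; the average of `n` indicator
  -- errors, each below `ε / (4 * C)`, adds at most another `ε / 2`.
  obtain ⟨m, hm⟩ := exists_nat_one_div_lt (show 0 < ε / (4 * C) by positivity)
  let n := m + 1
  have hn : 0 < n := m.succ_pos
  have hn' : (0 : ℝ) < n := by exact_mod_cast hn
  have hnε : 2 * C * (1 / n) < ε / 2 := by
    have h1 : (1 : ℝ) / n < ε / (4 * C) := by simpa [n] using hm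
    calc 2 * C * (1 / n) < 2 * C * (ε / (4 * C)) := by gcongr
      _ = ε / 2 := by field_simp; norm_num
  let U : ℕ → Set (LocFinMeasure S) := fun k => {μ | (k : ℝ) ≤ n * f₀ μ}
  have hUm : ∀ k, MeasurableSet (U k) := fun k =>
    measurableSet_le measurable_const (((hf.add_const C).div_const _).const_mul _)
  have hUu : ∀ k, IsUpperSet (U k) := fun k μ ν hμν hμ => by
    refine le_trans (show (k : ℝ) ≤ n * f₀ μ from hμ) ?_
    have := hfm hμν
    simp only [f₀]
    gcongr
  choose h hcyl hh01 hhP using fun k =>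
    exists_isMonotoneCylinder_indicator hI P hM (hUm k) (hUu k)
      (show 0 < ε / (4 * C) by positivity)
  have hsum01 : ∀ x, (1 : ℝ) / n * ∑ k ∈ Finset.Icc 1 n, h k x ∈ Icc (0 : ℝ) 1 := by
    intro x
    have h0 : 0 ≤ ∑ k ∈ Finset.Icc 1 n, h k x := Finset.sum_nonneg fun k _ => (hh01 k x).1
    have h1 : ∑ k ∈ Finset.Icc 1 n, h k x ≤ n := by
      refine (Finset.sum_le_sum fun k _ => (hh01 k x).2).trans ?_
      simp
    refine ⟨by positivity, ?_⟩
    rw [one_div, inv_mul_le_iff₀ hn', mul_one]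
    exact h1
  refine ⟨fun x => -C + 2 * C * (1 / n * ∑ k ∈ Finset.Icc 1 n, h k x), ?_, fun x => ?_, ?_⟩
  · exact (IsMonotoneCylinder.const (-C)).add
      (((IsMonotoneCylinder.sum _ fun k _ => hcyl k).const_mul (by positivity)).const_mul
        (by positivity))
  · have h1 := hsum01 x
    have h2 := mul_le_mul_of_nonneg_left h1.2 (show 0 ≤ 2 * C by positivity)
    have h3 := mul_nonneg (show 0 ≤ 2 * C by positivity) h1.1
    exact abs_le.2 ⟨by linarith, by linarith⟩
  · let e : ℕ → Ω → ℝ := fun k ω =>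
      |(U k).indicator (fun _ => (1 : ℝ)) (M ω) - h k (evalOn I (M ω))|
    have hem : ∀ k, Measurable (e k) := fun k =>
      (((measurable_const.indicator (hUm k)).comp hM).sub
        ((hcyl k).continuous.measurable.comp hXm)).abs
    have hei : ∀ k, Integrable (e k) P := fun k => by
      refine Integrable.of_bound (hem k).aestronglyMeasurable 1 (.of_forall fun ω => ?_)
      have h1 := hh01 k (evalOn I (M ω))
      simp only [e, Real.norm_eq_abs, abs_abs]
      by_cases hω : M ω ∈ U k
      · rw [indicator_of_mem hω]
        exact abs_le.2 ⟨by linarith [h1.2], by linarith [h1.1]⟩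
      · rw [indicator_of_notMem hω]
        exact abs_le.2 ⟨by linarith [h1.2], by linarith [h1.1]⟩
    have hpt : ∀ ω, |f (M ω) - (-C + 2 * C * (1 / n * ∑ k ∈ Finset.Icc 1 n,
        h k (evalOn I (M ω))))| ≤
        2 * C * (1 / n) + 2 * C * (1 / n) * ∑ k ∈ Finset.Icc 1 n, e k ω := by
      intro ω
      have hst := abs_sub_staircase_le (hf₀ (M ω)) hn
      have hind : ∀ k : ℕ, (if (k : ℝ) ≤ n * f₀ (M ω) then (1 : ℝ) else 0) =
          (U k).indicator (fun _ => (1 : ℝ)) (M ω) := fun k => rfl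
      simp_rw [hind] at hst
      have hsum : |∑ k ∈ Finset.Icc 1 n, ((U k).indicator (fun _ => (1 : ℝ)) (M ω) -
          h k (evalOn I (M ω)))| ≤ ∑ k ∈ Finset.Icc 1 n, e k ω :=
        Finset.abs_sum_le_sum_abs _ _
      rw [Finset.sum_sub_distrib] at hsum
      set s := ∑ k ∈ Finset.Icc 1 n, (U k).indicator (fun _ => (1 : ℝ)) (M ω)
      set t := ∑ k ∈ Finset.Icc 1 n, h k (evalOn I (M ω))
      have hfeq : f (M ω) = -C + 2 * C * f₀ (M ω) := by
        simp only [f₀]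
        field_simp
        ring
      have : f (M ω) - (-C + 2 * C * (1 / n * t)) =
          2 * C * (f₀ (M ω) - 1 / n * s) + 2 * C * (1 / n) * (s - t) := by
        rw [hfeq]
        ring
      rw [this]
      refine (abs_add_le _ _).trans ?_
      rw [abs_mul (2 * C), abs_mul (2 * C * (1 / (n : ℝ))),
        abs_of_pos (show 0 < 2 * C by positivity),
        abs_of_pos (show 0 < 2 * C * (1 / (n : ℝ)) by positivity)]
      gcongr
    have hesum : Integrable (fun ω => ∑ k ∈ Finset.Icc 1 n, e k ω) P :=
      integrable_finsetSum _ fun k _ => hei k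
    calc ∫ ω, |f (M ω) - (-C + 2 * C * (1 / n * ∑ k ∈ Finset.Icc 1 n,
          h k (evalOn I (M ω))))| ∂P
        ≤ ∫ ω, (2 * C * (1 / n) + 2 * C * (1 / n) * ∑ k ∈ Finset.Icc 1 n, e k ω) ∂P :=
          integral_mono_of_nonneg (.of_forall fun ω => abs_nonneg _)
            ((integrable_const _).add (hesum.const_mul _)) (.of_forall hpt)
      _ = 2 * C * (1 / n) + 2 * C * (1 / n) * ∑ k ∈ Finset.Icc 1 n, ∫ ω, e k ω ∂P := by
          rw [integral_add (integrable_const _) (hesum.const_mul _), integral_const_mul (2 * C * (1 / (n : ℝ))),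
            integral_finsetSum _ fun k _ => hei k]
          simp
      _ ≤ 2 * C * (1 / n) + 2 * C * (1 / n) * ∑ k ∈ Finset.Icc 1 n, ε / (4 * C) := by
          gcongr with k
          exact (hhP k).le
      _ = 2 * C * (1 / n) + ε / 2 := by
          rw [Finset.sum_const, Nat.card_Icc, nsmul_eq_mul, Nat.add_sub_cancel]
          field_simp
          ring
      _ < ε := by linarith

/-! ### Localisation to a Borel set -/

/-- The restriction of a locally finite measure. -/
noncomputable def restrict (A : Set S) (μ : LocFinMeasure S) : LocFinMeasure S :=
  ⟨(μ : Measure S).restrict A, fun B hBm hB =>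
    (Measure.restrict_apply_le _ _).trans_lt (μ.2 B hBm hB)⟩

theorem measurable_restrict {A : Set S} (hA : MeasurableSet A) :
    Measurable (restrict A : LocFinMeasure S → LocFinMeasure S) :=
  (Measure.measurable_of_measurable_coe _ fun B hB => by
    simp_rw [Measure.restrict_apply hB]
    exact measurable_apply (hB.inter hA)).subtype_mk

theorem evalSigma_le (A : Set S) :
    evalSigma A ≤ (inferInstance : MeasurableSpace (LocFinMeasure S)) :=
  iSup_le fun _ => iSup_le fun hB => iSup_le fun _ => (measurable_apply hB).comap_le

theorem evalSigma_mono {A B : Set S} (h : A ⊆ B) : evalSigma A ≤ evalSigma B :=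
  iSup_mono fun _ => iSup_mono fun _ => iSup_mono' fun hC => ⟨hC.trans h, le_rfl⟩

theorem evalSigma_le_comap_restrict {A : Set S} :
    evalSigma A ≤ MeasurableSpace.comap (restrict A) inferInstance := by
  refine iSup_le fun B => iSup_le fun hB => iSup_le fun hBA => ?_
  have : (fun μ : LocFinMeasure S => (μ : Measure S) B) =
      (fun μ : LocFinMeasure S => (μ : Measure S) B) ∘ restrict A := by
    ext μ
    simp [restrict, Measure.restrict_apply hB, inter_eq_left.2 hBA]
  rw [this, ← MeasurableSpace.comap_comp]
  exact MeasurableSpace.comap_mono (measurable_apply hB).comap_le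

/-- Functionals measurable with respect to `A` only depend on the restriction to `A`. -/
theorem apply_restrict {A : Set S} (hA : MeasurableSet A) {f : LocFinMeasure S → ℝ}
    (hf : Measurable[evalSigma A] f) (μ : LocFinMeasure S) : f (restrict A μ) = f μ := by
  have hf' : Measurable[MeasurableSpace.comap (restrict A) inferInstance] f :=
    hf.mono evalSigma_le_comap_restrict le_rfl
  -- `f` factors through `restrict A`, which is idempotent.
  refine hf'.factorsThrough (Subtype.ext ?_)
  simp [restrict, Measure.restrict_restrict hA]

end LocFinMeasure

/-! ### Correlation inequalities for cylinder functions -/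

namespace IsCountableDissectingSemiring

variable {S : Type*} [MetricSpace S] [MeasurableSpace S] {I : Set (Set S)}

/-- A finite family of finite unions of members of the semiring is subordinate to a nonempty
finite sequence of pairwise disjoint members. -/
theorem exists_fin_disjoint_refinement (hI : IsCountableDissectingSemiring I)
    (F : Finset (Set S)) (hF : ↑F ⊆ supClosure I) :
    ∃ n : ℕ, 1 ≤ n ∧ ∃ D : Fin n → Set S, (∀ i, D i ∈ I) ∧
      (Pairwise fun i j => Disjoint (D i) (D j)) ∧
      ∀ E ∈ F, ∀ x ∈ E, ∃ i, x ∈ D i ∧ D i ⊆ E := by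
  classical
  obtain ⟨G, hGI, hG, hGF⟩ := hI.isSetSemiring.exists_disjoint_refinement F hF
  -- Adding the empty set guarantees at least one piece and keeps the family disjoint.
  let G' := insert ∅ G
  have hG'I : ∀ D ∈ G', D ∈ I := fun D hD => by
    rcases Finset.mem_insert.1 hD with rfl | h
    · exact hI.isSetSemiring.empty_mem
    · exact hGI h
  refine ⟨G'.card, Finset.card_pos.2 ⟨∅, Finset.mem_insert_self _ _⟩,
    fun i => G'.equivFin.symm i, fun i => hG'I _ (G'.equivFin.symm i).2, fun i j hij => ?_,
    fun E hE x hx => ?_⟩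
  · have hne : (G'.equivFin.symm i : Set S) ≠ G'.equivFin.symm j := fun h =>
      hij (G'.equivFin.symm.injective (Subtype.ext h))
    rcases Finset.mem_insert.1 (G'.equivFin.symm i).2 with h | h
    · simp [h]
    rcases Finset.mem_insert.1 (G'.equivFin.symm j).2 with h' | h'
    · simp [h']
    exact hG h h' hne
  · rw [hGF E hE] at hx
    obtain ⟨D, ⟨hD, hDE⟩, hxD⟩ := hx
    exact ⟨G'.equivFin ⟨D, Finset.mem_insert_of_mem hD⟩, by simpa using hxD, by simpa using hDE⟩

open Classical in
/-- The mass of a set in terms of the masses of the members of a subordinate sequence. -/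
theorem measureReal_eq_sum (hI : IsCountableDissectingSemiring I) (μ : LocFinMeasure S) {n : ℕ}
    {D : Fin n → Set S} (hDI : ∀ i, D i ∈ I) (hD : Pairwise fun i j => Disjoint (D i) (D j))
    {E : Set S} (J : Set (Fin n)) (hE : ∀ x ∈ E, ∃ i ∈ J, x ∈ D i ∧ D i ⊆ E) :
    (μ : Measure S).real E =
      ∑ i : J, if D i ⊆ E then (μ : Measure S).real (D i) else 0 := by
  have hEeq : E = ⋃ i ∈ Finset.univ.filter (fun i : J => D i ⊆ E), D i := by
    ext x
    simp only [Finset.mem_filter, Finset.mem_univ, true_and, mem_iUnion, exists_prop]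
    constructor
    · intro hx
      obtain ⟨i, hi, hxi, hiE⟩ := hE x hx
      exact ⟨⟨i, hi⟩, hiE, hxi⟩
    · rintro ⟨i, hiE, hxi⟩
      exact hiE hxi
  rw [← Finset.sum_filter]
  conv_lhs => rw [hEeq]
  refine measureReal_biUnion_finset (fun i _ j _ hij => hD fun h => hij (Subtype.ext h))
    (fun i _ => hI.measurableSet _ (hDI _)) fun i _ => (hI.measure_lt_top μ (hDI _)).ne

end IsCountableDissectingSemiring

section SubordinateSums

variable {S : Type*} {I : Set (Set S)}

open Classical in
/-- The sums of a vector over the members of a sequence of sets contained in given sets. -/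
noncomputable def subordinateSums {n : ℕ} (D : Fin n → Set S) (E : I → Set S) (J : Set (Fin n))
    (x : J → ℝ) : I → ℝ :=
  fun B => ∑ i : J, if D i ⊆ E B then x i else 0

theorem monotone_subordinateSums {n : ℕ} (D : Fin n → Set S) (E : I → Set S) (J : Set (Fin n)) :
    Monotone (subordinateSums D E J) := fun x y hxy B =>
  Finset.sum_le_sum fun i _ => by
    split_ifs
    · exact hxy i
    · exact le_rfl

theorem continuous_subordinateSums {n : ℕ} (D : Fin n → Set S) (E : I → Set S)
    (J : Set (Fin n)) : Continuous (subordinateSums D E J) :=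
  continuous_pi fun B => continuous_finsetSum _ fun i _ => by
    split_ifs
    · exact continuous_apply i
    · exact continuous_const

end SubordinateSums

section FiniteDimensional

variable {S Ω : Type*} [MetricSpace S] [MeasurableSpace S] [MeasurableSpace Ω] {I : Set (Set S)}

/-- Finite-dimensional negative association, for cylinder functions of the traces of a random
measure on a ring set and on its complement. -/
theorem integral_mul_le_of_forall_isNegAssociated (hI : IsCountableDissectingSemiring I)
    (P : Measure Ω) {M : Ω → LocFinMeasure S}
    (hNA : ∀ n : ℕ, 1 ≤ n → ∀ B : Fin n → Set S, (∀ i, B i ∈ I) →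
      (Pairwise fun i j => Disjoint (B i) (B j)) →
      IsNegAssociated P (fun i ω => (M ω : Measure S).real (B i)))
    {h k : (I → ℝ) → ℝ} (hh : IsMonotoneCylinder h) (hk : IsMonotoneCylinder k) {C : ℝ}
    (hhC : ∀ x, |h x| ≤ C) (hkC : ∀ x, |k x| ≤ C) {R : Set S} (hR : R ∈ supClosure I) :
    ∫ ω, h (fun B => (M ω : Measure S).real (B ∩ R)) *
        k (fun B => (M ω : Measure S).real (B \ R)) ∂P ≤
      (∫ ω, h (fun B => (M ω : Measure S).real (B ∩ R)) ∂P) *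
        ∫ ω, k (fun B => (M ω : Measure S).real (B \ R)) ∂P := by
  classical
  obtain ⟨F, hF⟩ := hh.dependsOn
  obtain ⟨G, hG⟩ := hk.dependsOn
  have hring := hI.isSetSemiring.isSetRing_supClosure
  obtain ⟨n, hn, D, hDI, hD, hDE⟩ := hI.exists_fin_disjoint_refinement
    (F.image (fun B : I => (B : Set S) ∩ R) ∪ G.image fun B : I => (B : Set S) \ R) (by
      intro E hE
      simp only [Finset.coe_union, Finset.coe_image, mem_union, mem_image] at hE
      rcases hE with ⟨B, -, rfl⟩ | ⟨B, -, rfl⟩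
      · exact hring.inter_mem (subset_supClosure B.2) hR
      · exact hring.sdiff_mem (subset_supClosure B.2) hR)
  -- Pieces making up `B ∩ R` lie in `R`, while nonempty pieces making up `B \ R` do not. Thus `h`
  -- reads only the coordinates in `J` and `k` only those outside.
  let J : Set (Fin n) := {i | D i ⊆ R}
  have hcountable : Countable I := hI.countable.to_subtype
  have hhM : ∀ ω, h (subordinateSums D (fun B : I => (B : Set S) ∩ R) J
      fun i => (M ω : Measure S).real (D i)) =
        h fun B => (M ω : Measure S).real (B ∩ R) := fun ω => hF fun B hB => by
    refine (hI.measureReal_eq_sum (M ω) hDI hD J fun x hx => ?_).symm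
    obtain ⟨i, hxi, hi⟩ := hDE _ (Finset.mem_union_left _
      (Finset.mem_image_of_mem (fun B : I => (B : Set S) ∩ R) hB)) x hx
    exact ⟨i, hi.trans inter_subset_right, hxi, hi⟩
  have hkM : ∀ ω, k (subordinateSums D (fun B : I => (B : Set S) \ R) Jᶜ
      fun i => (M ω : Measure S).real (D i)) =
        k fun B => (M ω : Measure S).real (B \ R) := fun ω => hG fun B hB => by
    refine (hI.measureReal_eq_sum (M ω) hDI hD Jᶜ fun x hx => ?_).symm
    obtain ⟨i, hxi, hi⟩ := hDE _ (Finset.mem_union_right _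
      (Finset.mem_image_of_mem (fun B : I => (B : Set S) \ R) hB)) x hx
    exact ⟨i, fun hiJ => (hi hxi).2 (hiJ hxi), hxi, hi⟩
  have := hNA n hn D hDI hD J (h ∘ subordinateSums D (fun B : I => (B : Set S) ∩ R) J)
    (k ∘ subordinateSums D (fun B : I => (B : Set S) \ R) Jᶜ)
    (hh.continuous.comp (continuous_subordinateSums _ _ _)).measurable
    (hk.continuous.comp (continuous_subordinateSums _ _ _)).measurable
    (hh.monotone.comp (monotone_subordinateSums _ _ _))
    (hk.monotone.comp (monotone_subordinateSums _ _ _))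
    ⟨C, fun x => hhC _⟩ ⟨C, fun x => hkC _⟩
  simpa only [Function.comp_apply, hhM, hkM] using this

/-- Finite-dimensional positive association, for cylinder functions of a random measure. -/
theorem integral_mul_integral_le_of_forall_isPosAssociated (hI : IsCountableDissectingSemiring I)
    (P : Measure Ω) {M : Ω → LocFinMeasure S}
    (hPA : ∀ n : ℕ, 1 ≤ n → ∀ B : Fin n → Set S, (∀ i, B i ∈ I) →
      (Pairwise fun i j => Disjoint (B i) (B j)) →
      IsPosAssociated P (fun i ω => (M ω : Measure S).real (B i)))
    {h k : (I → ℝ) → ℝ} (hh : IsMonotoneCylinder h) (hk : IsMonotoneCylinder k) {C : ℝ}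
    (hhC : ∀ x, |h x| ≤ C) (hkC : ∀ x, |k x| ≤ C) :
    (∫ ω, h (LocFinMeasure.evalOn I (M ω)) ∂P) * ∫ ω, k (LocFinMeasure.evalOn I (M ω)) ∂P ≤
      ∫ ω, h (LocFinMeasure.evalOn I (M ω)) * k (LocFinMeasure.evalOn I (M ω)) ∂P := by
  classical
  obtain ⟨F, hF⟩ := hh.dependsOn
  obtain ⟨G, hG⟩ := hk.dependsOn
  obtain ⟨n, hn, D, hDI, hD, hDE⟩ := hI.exists_fin_disjoint_refinement
    ((F ∪ G).image fun B : I => (B : Set S)) (by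
      intro E hE
      simp only [Finset.coe_image, mem_image] at hE
      obtain ⟨B, -, rfl⟩ := hE
      exact subset_supClosure B.2)
  have hcountable : Countable I := hI.countable.to_subtype
  have hsum : ∀ ω, ∀ B ∈ F ∪ G, subordinateSums D (fun B : I => (B : Set S)) univ
      (fun i => (M ω : Measure S).real (D i)) B = LocFinMeasure.evalOn I (M ω) B := by
    intro ω B hB
    refine (hI.measureReal_eq_sum (M ω) hDI hD univ fun x hx => ?_).symm
    obtain ⟨i, hi⟩ := hDE _ (Finset.mem_image_of_mem (fun B : I => (B : Set S)) hB) x hx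
    exact ⟨i, mem_univ i, hi⟩
  have hhM : ∀ ω, h (subordinateSums D (fun B : I => (B : Set S)) univ
      fun i => (M ω : Measure S).real (D i)) = h (LocFinMeasure.evalOn I (M ω)) := fun ω =>
    hF fun B hB => hsum ω B (Finset.mem_union_left _ hB)
  have hkM : ∀ ω, k (subordinateSums D (fun B : I => (B : Set S)) univ
      fun i => (M ω : Measure S).real (D i)) = k (LocFinMeasure.evalOn I (M ω)) := fun ω =>
    hG fun B hB => hsum ω B (Finset.mem_union_right _ hB)
  have := hPA n hn D hDI hD univ (h ∘ subordinateSums D (fun B : I => (B : Set S)) univ)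
    (k ∘ subordinateSums D (fun B : I => (B : Set S)) univ)
    (hh.continuous.comp (continuous_subordinateSums _ _ _)).measurable
    (hk.continuous.comp (continuous_subordinateSums _ _ _)).measurable
    (hh.monotone.comp (monotone_subordinateSums _ _ _))
    (hk.monotone.comp (monotone_subordinateSums _ _ _))
    ⟨C, fun x => hhC _⟩ ⟨C, fun x => hkC _⟩
  simpa only [Function.comp_apply, hhM, hkM] using this

/-- A Borel set is approximated by ring sets, almost surely for the restriction of a random
measure to a bounded set. -/
theorem exists_seq_supClosure_tendsto (hI : IsCountableDissectingSemiring I)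
    (P : Measure Ω) [IsFiniteMeasure P] {M : Ω → LocFinMeasure S} (hM : Measurable M)
    {A W : Set S} (hA : MeasurableSet A) (hW : MeasurableSet W) (hWb : Bornology.IsBounded W) :
    ∃ R : ℕ → Set S, (∀ n, R n ∈ supClosure I) ∧
      ∀ᵐ ω ∂P, Tendsto (fun n => (M ω : Measure S).real (R n ∆ A ∩ W)) atTop (𝓝 0) := by
  obtain ⟨ν, hν, hνM⟩ := exists_isFiniteMeasure_tendsto_inter_zero P
    (measurable_subtype_coe.comp hM) hW fun ω => ((M ω).2 W hW hWb).ne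
  obtain ⟨u, hu, hsum⟩ := ENNReal.exists_pos_sum_of_countable' one_ne_zero ℕ
  choose R hRI hRA using fun n => hI.exists_supClosure_symmDiff_lt ν hA (hu n)
  refine ⟨R, hRI, ?_⟩
  have hsum' : ∑' n, ν (R n ∆ A) ≠ ∞ :=
    ((ENNReal.tsum_le_tsum fun n => (hRA n).le).trans_lt (hsum.trans ENNReal.one_lt_top)).ne
  filter_upwards [hνM (fun n => R n ∆ A)
    (fun n => (hI.measurableSet_supClosure (hRI n)).symmDiff hA) hsum'] with ω hω
  exact (ENNReal.tendsto_toReal ENNReal.zero_ne_top).comp hω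

/-- Masses differ by at most the mass of the symmetric difference. Since `Δ n` is arbitrary, the
single error set `R n ∆ A` can serve all coordinates of a cylinder function. -/
theorem tendsto_measureReal_of_symmDiff {α : Type*} [MeasurableSpace α] (μ : Measure α)
    {W : Set α} (hW : μ W ≠ ∞) {E : ℕ → Set α} {E₀ : Set α} {Δ : ℕ → Set α}
    (hE : ∀ n, MeasurableSet (E n)) (hE₀ : MeasurableSet E₀) (hEW : ∀ n, E n ⊆ W) (hE₀W : E₀ ⊆ W)
    (hΔ : ∀ n, E n ∆ E₀ ⊆ Δ n ∩ W)
    (hlim : Tendsto (fun n => μ.real (Δ n ∩ W)) atTop (𝓝 0)) :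
    Tendsto (fun n => μ.real (E n)) atTop (𝓝 (μ.real E₀)) := by
  have hfin : ∀ s ⊆ W, μ s ≠ ∞ := fun s hs => ne_top_of_le_ne_top hW (measure_mono hs)
  refine tendsto_iff_dist_tendsto_zero.2 (squeeze_zero (fun _ => dist_nonneg) (fun n => ?_) hlim)
  rw [Real.dist_eq]
  exact (abs_measureReal_sub_le_measureReal_symmDiff' (hE n).nullMeasurableSet
    hE₀.nullMeasurableSet (hfin _ (hEW n)) (hfin _ hE₀W)).trans
      (measureReal_mono (hΔ n) (hfin _ inter_subset_right))

/-- Negative correlation of cylinder functions of the restrictions of a random measure to a Borel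
set and to its complement. -/
theorem integral_mul_le_of_restrict (hI : IsCountableDissectingSemiring I)
    (P : Measure Ω) [IsProbabilityMeasure P] {M : Ω → LocFinMeasure S} (hM : Measurable M)
    (hNA : ∀ n : ℕ, 1 ≤ n → ∀ B : Fin n → Set S, (∀ i, B i ∈ I) →
      (Pairwise fun i j => Disjoint (B i) (B j)) →
      IsNegAssociated P (fun i ω => (M ω : Measure S).real (B i)))
    {h k : (I → ℝ) → ℝ} (hh : IsMonotoneCylinder h) (hk : IsMonotoneCylinder k) {C : ℝ}
    (hhC : ∀ x, |h x| ≤ C) (hkC : ∀ x, |k x| ≤ C) {A : Set S} (hA : MeasurableSet A) :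
    ∫ ω, h (fun B => (M ω : Measure S).real (B ∩ A)) *
        k (fun B => (M ω : Measure S).real (B \ A)) ∂P ≤
      (∫ ω, h (fun B => (M ω : Measure S).real (B ∩ A)) ∂P) *
        ∫ ω, k (fun B => (M ω : Measure S).real (B \ A)) ∂P := by
  classical
  have hcountable : Countable I := hI.countable.to_subtype
  obtain ⟨F, hF⟩ := hh.dependsOn
  obtain ⟨G, hG⟩ := hk.dependsOn
  -- Only finitely many coordinates matter, so `A` need only be approximated inside one bounded set.
  let W : Set S := ⋃ B ∈ F ∪ G, (B : Set S)
  have hW : MeasurableSet W := Finset.measurableSet_biUnion _ fun B _ => hI.measurableSet B B.2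
  have hWb : Bornology.IsBounded W :=
    (Bornology.isBounded_biUnion_finset _).2 fun B _ => hI.isBounded B B.2
  obtain ⟨R, hR, hlim⟩ := exists_seq_supClosure_tendsto hI P hM hA hW hWb
  have hRm := fun n => hI.measurableSet_supClosure (hR n)
  have hBW : ∀ B ∈ F ∪ G, (B : Set S) ⊆ W := fun B hB =>
    subset_biUnion_of_mem (u := fun B : I => (B : Set S)) hB
  have hlimh : ∀ᵐ ω ∂P, Tendsto (fun n => h fun B => (M ω : Measure S).real (B ∩ R n)) atTop
      (𝓝 (h fun B => (M ω : Measure S).real (B ∩ A))) := by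
    filter_upwards [hlim] with ω hω
    refine hh.tendsto hF fun B hB => ?_
    have hB' := hBW B (Finset.mem_union_left _ hB)
    have hBm := hI.measurableSet B B.2
    refine tendsto_measureReal_of_symmDiff _ ((M ω).2 W hW hWb).ne (fun n => hBm.inter (hRm n))
      (hBm.inter hA) (fun n => inter_subset_left.trans hB') (inter_subset_left.trans hB')
      (fun n x hx => ?_) hω
    simp only [mem_inter_iff, Set.mem_symmDiff] at hx ⊢
    have := @hB' x
    tauto
  have hlimk : ∀ᵐ ω ∂P, Tendsto (fun n => k fun B => (M ω : Measure S).real (B \ R n)) atTop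
      (𝓝 (k fun B => (M ω : Measure S).real (B \ A))) := by
    filter_upwards [hlim] with ω hω
    refine hk.tendsto hG fun B hB => ?_
    have hB' := hBW B (Finset.mem_union_right _ hB)
    have hBm := hI.measurableSet B B.2
    refine tendsto_measureReal_of_symmDiff _ ((M ω).2 W hW hWb).ne (fun n => hBm.diff (hRm n))
      (hBm.diff hA) (fun n => sdiff_subset.trans hB') (sdiff_subset.trans hB')
      (fun n x hx => ?_) hω
    simp only [mem_inter_iff, Set.mem_sdiff, Set.mem_symmDiff] at hx ⊢
    have := @hB' x
    tauto
  have hmeas : ∀ E : I → Set S, (∀ B, MeasurableSet (E B)) →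
      Measurable fun ω => fun B : I => (M ω : Measure S).real (E B) := fun E hE =>
    measurable_pi_lambda _ fun B =>
      ((LocFinMeasure.measurable_apply (hE B)).comp hM).ennreal_toReal
  have hhm : ∀ n, Measurable fun ω => h fun B => (M ω : Measure S).real (B ∩ R n) := fun n =>
    hh.continuous.measurable.comp
      (hmeas (fun B => B ∩ R n) fun B => (hI.measurableSet B B.2).inter (hRm n))
  have hkm : ∀ n, Measurable fun ω => k fun B => (M ω : Measure S).real (B \ R n) := fun n =>
    hk.continuous.measurable.comp
      (hmeas (fun B => B \ R n) fun B => (hI.measurableSet B B.2).diff (hRm n))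
  have hC : 0 ≤ C := (abs_nonneg _).trans (hhC 0)
  have t1 := tendsto_integral_of_dominated_convergence (μ := P) (fun _ => C)
    (fun n => (hhm n).aestronglyMeasurable) (integrable_const _)
    (fun n => .of_forall fun ω => hhC _) hlimh
  have t2 := tendsto_integral_of_dominated_convergence (μ := P) (fun _ => C)
    (fun n => (hkm n).aestronglyMeasurable) (integrable_const _)
    (fun n => .of_forall fun ω => hkC _) hlimk
  have t3 := tendsto_integral_of_dominated_convergence (μ := P) (fun _ => C * C)
    (fun n => ((hhm n).mul (hkm n)).aestronglyMeasurable) (integrable_const _)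
    (fun n => .of_forall fun ω => by
      rw [Pi.mul_apply, norm_mul]
      exact mul_le_mul (hhC _) (hkC _) (norm_nonneg _) hC)
    (by filter_upwards [hlimh, hlimk] with ω h1 h2 using h1.mul h2)
  exact le_of_tendsto_of_tendsto' t3 (t1.mul t2) fun n =>
    integral_mul_le_of_forall_isNegAssociated hI P hNA hh hk hhC hkC (hR n)

end FiniteDimensional

/-! ### The equivalences -/

section Association

variable {S Ω : Type*} [MetricSpace S] [MeasurableSpace S] [MeasurableSpace Ω] {I : Set (Set S)}

theorem LocFinMeasure.monotone_real {n : ℕ} (hI : IsCountableDissectingSemiring I)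
    {B : Fin n → Set S} (hB : ∀ i, B i ∈ I) (J : Set (Fin n)) :
    Monotone fun (μ : LocFinMeasure S) (i : J) => (μ : Measure S).real (B i) :=
  fun _ ν hμν _ => ENNReal.toReal_mono (hI.measure_lt_top ν (hB _)).ne (hμν _)

theorem LocFinMeasure.measurable_evalSigma_real {n : ℕ} (hI : IsCountableDissectingSemiring I)
    {B : Fin n → Set S} (hB : ∀ i, B i ∈ I) (J : Set (Fin n)) :
    Measurable[evalSigma (⋃ i ∈ J, B i)]
      fun (μ : LocFinMeasure S) (i : J) => (μ : Measure S).real (B i) := by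
  refine @measurable_pi_lambda _ _ _ (evalSigma (⋃ i ∈ J, B i)) _ _ fun i => ?_
  have h : Measurable[evalSigma (⋃ i ∈ J, B i)]
      fun μ : LocFinMeasure S => (μ : Measure S) (B i) :=
    measurable_iff_comap_le.2 (le_iSup₂_of_le (B i) (hI.measurableSet _ (hB i))
      (le_iSup_of_le (subset_biUnion_of_mem (u := B) i.2) le_rfl))
  exact h.ennreal_toReal

/-- The subvectors over `J` and `Jᶜ` are non-decreasing functions of `M`, measurable with respect to
the disjoint unions of the corresponding `B i`. -/
theorem IsNegAssociatedRM.isNegAssociated (hI : IsCountableDissectingSemiring I)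
    {P : Measure Ω} {M : Ω → LocFinMeasure S} (h : IsNegAssociatedRM P M) {n : ℕ}
    {B : Fin n → Set S} (hB : ∀ i, B i ∈ I) (hd : Pairwise fun i j => Disjoint (B i) (B j)) :
    IsNegAssociated P (fun i ω => (M ω : Measure S).real (B i)) := by
  rintro J f g hf hg hfm hgm ⟨C, hC⟩ ⟨C', hC'⟩
  have hm : ∀ J : Set (Fin n), MeasurableSet (⋃ i ∈ J, B i) := fun J =>
    MeasurableSet.biUnion J.to_countable fun i _ => hI.measurableSet _ (hB i)
  refine h (⋃ i ∈ J, B i) (⋃ i ∈ Jᶜ, B i) (hm _) (hm _) ?_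
    (fun μ => f fun i => (μ : Measure S).real (B i))
    (fun μ => g fun i => (μ : Measure S).real (B i))
    (hf.comp (LocFinMeasure.measurable_evalSigma_real hI hB J))
    (hg.comp (LocFinMeasure.measurable_evalSigma_real hI hB Jᶜ))
    (hfm.comp (LocFinMeasure.monotone_real hI hB J))
    (hgm.comp (LocFinMeasure.monotone_real hI hB Jᶜ)) ⟨C, fun μ => hC _⟩ ⟨C', fun μ => hC' _⟩
  exact disjoint_iUnion₂_left.2 fun i hi => disjoint_iUnion₂_right.2 fun j hj =>
    hd fun h => hj (h ▸ hi)

theorem IsPosAssociatedRM.isPosAssociated (hI : IsCountableDissectingSemiring I)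
    {P : Measure Ω} {M : Ω → LocFinMeasure S} (h : IsPosAssociatedRM P M) {n : ℕ}
    {B : Fin n → Set S} (hB : ∀ i, B i ∈ I) :
    IsPosAssociated P (fun i ω => (M ω : Measure S).real (B i)) := by
  rintro J f g hf hg hfm hgm ⟨C, hC⟩ ⟨C', hC'⟩
  have hm : Measurable fun (μ : LocFinMeasure S) (i : J) => (μ : Measure S).real (B i) :=
    (LocFinMeasure.measurable_evalSigma_real hI hB J).mono (LocFinMeasure.evalSigma_le _) le_rfl
  exact h (fun μ => f fun i => (μ : Measure S).real (B i))
    (fun μ => g fun i => (μ : Measure S).real (B i)) (hf.comp hm) (hg.comp hm)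
    (hfm.comp (LocFinMeasure.monotone_real hI hB J))
    (hgm.comp (LocFinMeasure.monotone_real hI hB J)) ⟨C, fun μ => hC _⟩ ⟨C', fun μ => hC' _⟩

/-- Approximating `f` along `M` restricted to `A`, and `g` along `M` restricted to `Aᶜ`, yields
cylinder functions that still look at disjoint parts of `M`. -/
theorem isNegAssociatedRM_of_forall_isNegAssociated [PolishSpace S] [BorelSpace S]
    (hI : IsCountableDissectingSemiring I) (P : Measure Ω) [IsProbabilityMeasure P]
    {M : Ω → LocFinMeasure S} (hM : Measurable M)
    (hNA : ∀ n : ℕ, 1 ≤ n → ∀ B : Fin n → Set S, (∀ i, B i ∈ I) →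
      (Pairwise fun i j => Disjoint (B i) (B j)) →
      IsNegAssociated P (fun i ω => (M ω : Measure S).real (B i))) :
    IsNegAssociatedRM P M := by
  rintro A A' hA hA' hAA' f g hf hg hfm hgm ⟨Cf, hCf⟩ ⟨Cg, hCg⟩
  have hcountable : Countable I := hI.countable.to_subtype
  -- With complementary sets, approximating `A` by ring sets handles both sides at once.
  have hg' : Measurable[evalSigma Aᶜ] g :=
    hg.mono (LocFinMeasure.evalSigma_mono (disjoint_right.1 hAA')) le_rfl
  have hf₀ : Measurable f := hf.mono (LocFinMeasure.evalSigma_le _) le_rfl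
  have hg₀ : Measurable g := hg.mono (LocFinMeasure.evalSigma_le _) le_rfl
  -- A common bound, kept positive because the rescaling to the unit interval divides by it.
  let C := max (max Cf Cg) 1
  have hC : 0 < C := lt_max_of_lt_right one_pos
  have hfC : ∀ μ, |f μ| ≤ C := fun μ => (hCf μ).trans ((le_max_left _ _).trans (le_max_left _ _))
  have hgC : ∀ μ, |g μ| ≤ C := fun μ => (hCg μ).trans ((le_max_right _ _).trans (le_max_left _ _))
  have hMA := (LocFinMeasure.measurable_restrict hA).comp hM
  have hMA' := (LocFinMeasure.measurable_restrict hA.compl).comp hM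
  refine integral_mul_le_of_forall_approx P (hf₀.comp hM) (hg₀.comp hM) (fun ω => hfC _)
    (fun ω => hgC _) fun ε hε => ?_
  obtain ⟨h, hh, hhC, hhP⟩ :=
    LocFinMeasure.exists_isMonotoneCylinder_approx hI P hMA hf₀ hfm hC hfC hε
  obtain ⟨k, hk, hkC, hkP⟩ :=
    LocFinMeasure.exists_isMonotoneCylinder_approx hI P hMA' hg₀ hgm hC hgC hε
  simp only [Function.comp_apply, LocFinMeasure.apply_restrict hA hf] at hhP
  simp only [Function.comp_apply, LocFinMeasure.apply_restrict hA.compl hg'] at hkP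
  refine ⟨_, _, hh.continuous.measurable.comp ((LocFinMeasure.measurable_evalOn hI).comp hMA),
    hk.continuous.measurable.comp ((LocFinMeasure.measurable_evalOn hI).comp hMA'),
    fun ω => hhC _, fun ω => hkC _, hhP, hkP, ?_⟩
  have e1 : ∀ μ : LocFinMeasure S, LocFinMeasure.evalOn I (LocFinMeasure.restrict A μ) =
      fun B : I => (μ : Measure S).real (B ∩ A) := fun μ => by
    ext B
    exact measureReal_restrict_apply (hI.measurableSet B B.2)
  have e2 : ∀ μ : LocFinMeasure S, LocFinMeasure.evalOn I (LocFinMeasure.restrict Aᶜ μ) =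
      fun B : I => (μ : Measure S).real (B \ A) := fun μ => by
    ext B
    exact measureReal_restrict_apply (hI.measurableSet B B.2)
  simp only [Function.comp_apply, e1, e2]
  exact integral_mul_le_of_restrict hI P hM hNA hh hk hhC hkC hA

theorem isPosAssociatedRM_of_forall_isPosAssociated [PolishSpace S] [BorelSpace S]
    (hI : IsCountableDissectingSemiring I) (P : Measure Ω) [IsProbabilityMeasure P]
    {M : Ω → LocFinMeasure S} (hM : Measurable M)
    (hPA : ∀ n : ℕ, 1 ≤ n → ∀ B : Fin n → Set S, (∀ i, B i ∈ I) →
      (Pairwise fun i j => Disjoint (B i) (B j)) →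
      IsPosAssociated P (fun i ω => (M ω : Measure S).real (B i))) :
    IsPosAssociatedRM P M := by
  rintro f g hf hg hfm hgm ⟨Cf, hCf⟩ ⟨Cg, hCg⟩
  have hcountable : Countable I := hI.countable.to_subtype
  let C := max (max Cf Cg) 1
  have hC : 0 < C := lt_max_of_lt_right one_pos
  have hfC : ∀ μ, |f μ| ≤ C := fun μ => (hCf μ).trans ((le_max_left _ _).trans (le_max_left _ _))
  have hgC : ∀ μ, |g μ| ≤ C := fun μ => (hCg μ).trans ((le_max_right _ _).trans (le_max_left _ _))
  -- Non-negative correlation of `f` and `g` is non-positive correlation of `f` and `-g`, so the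
  -- same stability lemma applies.
  have key := integral_mul_le_of_forall_approx P (hf.comp hM) (hg.comp hM).neg (fun ω => hfC _)
    (fun ω => (abs_neg _).trans_le (hgC _)) fun ε hε => by
      obtain ⟨h, hh, hhC, hhP⟩ :=
        LocFinMeasure.exists_isMonotoneCylinder_approx hI P hM hf hfm hC hfC hε
      obtain ⟨k, hk, hkC, hkP⟩ :=
        LocFinMeasure.exists_isMonotoneCylinder_approx hI P hM hg hgm hC hgC hε
      have hXm := (LocFinMeasure.measurable_evalOn hI).comp hM
      refine ⟨_, fun ω => -k (LocFinMeasure.evalOn I (M ω)), hh.continuous.measurable.comp hXm,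
        (hk.continuous.measurable.comp hXm).neg, fun ω => hhC _,
        fun ω => (abs_neg _).trans_le (hkC _), hhP, ?_, ?_⟩
      · refine lt_of_eq_of_lt (integral_congr_ae (.of_forall fun ω => ?_)) hkP
        change |-g (M ω) - -k _| = |g (M ω) - k _|
        rw [neg_sub_neg, abs_sub_comm]
      · simp only [mul_neg, integral_neg, Function.comp_apply, neg_le_neg_iff]
        exact integral_mul_integral_le_of_forall_isPosAssociated hI P hPA hh hk hhC hkC
  simpa only [Pi.neg_apply, Function.comp_apply, mul_neg, integral_neg, neg_le_neg_iff] using key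

end Association

theorem theorem4p4 {S Ω : Type*} [MetricSpace S] [PolishSpace S] [MeasurableSpace S]
    [BorelSpace S] [MeasurableSpace Ω] (P : Measure Ω) [IsProbabilityMeasure P]
    (M : Ω → LocFinMeasure S) (hM : Measurable M)
    (I : Set (Set S)) (hI : IsCountableDissectingSemiring I) :
    (IsNegAssociatedRM P M ↔
      ∀ n : ℕ, 1 ≤ n → ∀ B : Fin n → Set S, (∀ i, B i ∈ I) →
        (Pairwise fun i j => Disjoint (B i) (B j)) →
        IsNegAssociated P (fun i ω => (M ω : Measure S).real (B i))) ∧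
    (IsPosAssociatedRM P M ↔
      ∀ n : ℕ, 1 ≤ n → ∀ B : Fin n → Set S, (∀ i, B i ∈ I) →
        (Pairwise fun i j => Disjoint (B i) (B j)) →
        IsPosAssociated P (fun i ω => (M ω : Measure S).real (B i))) :=
  ⟨⟨fun h _ _ _ hB hd => h.isNegAssociated hI hB hd,
      isNegAssociatedRM_of_forall_isNegAssociated hI P hM⟩,
    ⟨fun h _ _ _ hB _ => h.isPosAssociated hI hB,
      isPosAssociatedRM_of_forall_isPosAssociated hI P hM⟩⟩
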